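/- Let $r\ge 3$, let $n_{\mathrm{cp}}$ be an integer with $1\le n_{\mathrm{cp}}<r-1$, and let $m\le n\le 8$ be natural numbers. **The scheme.** On a uniform mesh with cells $I_j=[x_{j-1/2},x_{j+1/2}]$ of size $\Delta x$, let $p_s$ ($s=0,\dots,r-1$) be the polynomial of degree $\le r-1$ whose averages over the $r$ cells $I_{j+s-r+1},\dots,I_{j+s}$ are the given cell averages, and put $u^s_{j+1/2}=p_s(x_{j+1/2})$. Let $$d_s=\binom{r}{s}\binom{r-1}{s}\Big/\binom{2r-1}{r}$$ be the ideal weights (those for which $\sum_s d_su^s_{j+1/2}$ is the reconstruction on the full stencil $I_{j-r+1},\dots,I_{j+r-1}$), let $\beta_s=\sum_{l=1}^{r-1}\Delta x^{2l-1}\int_{I_j}(p_s^{(l)})^2\,dx$, and let the WENO-JS weights with parameter $\epsilon$ be $\omega^{\mathrm{JS}}_s=\alpha_s/\sum_{l=0}^{r-1}\alpha_l$ with $\alpha_s=d_s/(\epsilon+\beta_s)^2$. The WENO-RM($mn0$) mapping with parameter $d$ is $$g^{\mathrm{RM}}(\omega;d)=d+\frac{(\omega-d)^{n+1}}{a_0+a_1\omega+\dots+a_{m+1}\omega^{m+1}},\qquad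 a_i=\binom{n+1}{i}(-d)^{n-i}\ (0\le i\le m),\qquad a_{m+1}=(1-d)^n-\sum_{i=0}^m a_i ,$$ and $m,n$ are assumed to be such that, for each $d=d_0,\dots,d_{r-1}$, the denominator has no zero $\omega\in[0,1]$, that is, the mapping functions are defined on $[0,1]$ (this holds, for example, for $m=2$, $n=6$). The order-preserving mapping is $g^{\mathrm{MOP}}(\omega)=g^{\mathrm{RM}}(\omega;d_{k^*})$, where $k^*=k^*(\omega)$ is the smallest index minimizing $|\omega-d_i|$ over $0\le i\le r-1$. The $(2r-1)$th-order MOP-WENO-RM($mn0$) weights are $$\omega_s=g^{\mathrm{MOP}}(\omega^{\mathrm{JS}}_s)\Big/\sum_{l=0}^{r-1}g^{\mathrm{MOP}}(\omega^{\mathrm{JS}}_l).$$ The left-biased value is $u^-_{j+1/2}=\sum_s\omega_su^s_{j+1/2}$, and $u^+_{j+1/2}$ is obtained from the mirror image with respect to $x_{j+1/2}$. For a flux $f$ the semi-discrete scheme is $\frac{d\bar u_j}{dt}=\mathcal L(\bar u)_j=-\frac1{\Delta x}(\hat f_{j+1/2}-\hat f_{j-1/2})$ with the Lax–Friedrichs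 flux $\hat f_{j+1/2}=\frac12\big[f(u^-_{j+1/2})+f(u^+_{j+1/2})-\alpha\,(u^+_{j+1/2}-u^-_{j+1/2})\big]$, $\alpha\in\mathbb R$ a constant. **Claim.** Suppose $$n\ \ge\ \frac{1+n_{\mathrm{cp}}}{r-1-n_{\mathrm{cp}}}.$$ Let $u:\mathbb R\to\mathbb R$ be $C^{2r}$ near a critical point $x_0$ of order $n_{\mathrm{cp}}$, i.e. $u'(x_0)=\dots=u^{(n_{\mathrm{cp}})}(x_0)=0\ne u^{(n_{\mathrm{cp}}+1)}(x_0)$, and let $f$ be $C^2$ near $u(x_0)$. Then the scheme has the optimal order of accuracy $2r-1$ at and near $x_0$: there are $C$, $\delta>0$ and $h_0>0$ such that for all $\epsilon\ge0$, all $0<\Delta x<h_0$ and every cell center $x_j$ with $|x_j-x_0|<\delta$, the scheme applied to the exact cell averages of $u$ satisfies $$\big|u^{\pm}_{j+1/2}-u(x_{j+1/2})\big|\le C\,\Delta x^{2r-1},\qquad \Big|\mathcal L(\bar u)_j+\frac{f(u(x_{j+1/2}))-f(u(x_{j-1/2}))}{\Delta x}\Big|\le C\,\Delta x^{2r-1}.$$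 -/

import Mathlib

noncomputable section

namespace MOPWENO

/-! Uniform mesh, seen from a fixed cell: the cell with index `i : ℤ` is, in the scaled coordinate
`ξ = (x - x_j) / Δx`, the interval `[i - 1/2, i + 1/2]`; its right boundary `i + 1/2` is `x_{j+i+1/2}`.
A function `v : ℤ → ℝ` is a family of cell averages. -/

/-- The reconstruction polynomial (in `ξ`) on the `k` consecutive cells `a, a+1, …, a+k-1`: the
polynomial of degree less than `k` whose averages over these cells are `v a, …, v (a+k-1)`.
It is the derivative of the polynomial that interpolates, at the `k + 1` cell boundaries, the
primitive `∑_{j<i} v (a+j)`. -/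
def reconPoly (a : ℤ) (k : ℕ) (v : ℤ → ℝ) : Polynomial ℝ :=
  Polynomial.derivative
    (Lagrange.interpolate (Finset.range (k + 1)) (fun i : ℕ => (a : ℝ) + (i : ℝ) - 1 / 2)
      (fun i : ℕ => ∑ j ∈ Finset.range i, v (a + (j : ℤ))))

/-- The reconstruction polynomial on the substencil `S_s`, consisting of the `r` cells
`s - r + 1, …, s` (`s = 0, …, r - 1`). -/
def subPoly (r s : ℕ) (v : ℤ → ℝ) : Polynomial ℝ :=
  reconPoly ((s : ℤ) - (r : ℤ) + 1) r v

/-- The substencil approximation `u^s_{j+1/2}` of order `r`. -/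
def subRecon (r s : ℕ) (v : ℤ → ℝ) : ℝ := (subPoly r s v).eval (1 / 2)

/-- The ideal weights `d_s`: the weights for which `∑_s d_s u^s_{j+1/2}` is the central upstream
reconstruction `(reconPoly (1 - r) (2 r - 1) v).eval (1/2)` of the `(2r-1)`-point global stencil.
For `r = 3` they are `1/10, 6/10, 3/10`. -/
def idealWeight (r s : ℕ) : ℝ :=
  ((r.choose s : ℝ) * ((r - 1).choose s : ℝ)) / ((2 * r - 1).choose r : ℝ)

/-- The Jiang–Shu smoothness indicator
`β_s = ∑_{l=1}^{r-1} Δx^{2l-1} ∫_{I_j} (d^l p_s / dx^l)^2 dx`, in the scaled coordinate. -/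
def smoothnessIndicator (r s : ℕ) (v : ℤ → ℝ) : ℝ :=
  ∑ l ∈ Finset.Icc 1 (r - 1),
    ∫ ξ in (-(1 / 2) : ℝ)..(1 / 2), ((Polynomial.derivative^[l] (subPoly r s v)).eval ξ) ^ 2

/-- The unnormalized WENO-JS weights. -/
def alphaJS (r : ℕ) (ε : ℝ) (v : ℤ → ℝ) (s : ℕ) : ℝ :=
  idealWeight r s / (ε + smoothnessIndicator r s v) ^ 2

/-- The nonlinear WENO-JS weights `ω_s^JS`. -/
def omegaJS (r : ℕ) (ε : ℝ) (v : ℤ → ℝ) (s : ℕ) : ℝ :=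
  alphaJS r ε v s / ∑ l ∈ Finset.range r, alphaJS r ε v l

/-- The coefficients `a_0, …, a_m` of the denominator of the WENO-RM(mn0) mapping. -/
def rmCoeff (n : ℕ) (d : ℝ) (i : ℕ) : ℝ :=
  ((n + 1).choose i : ℝ) * (-d) ^ (n - i)

/-- The last coefficient `a_{m+1}` of the denominator of the WENO-RM(mn0) mapping. -/
def rmLastCoeff (m n : ℕ) (d : ℝ) : ℝ :=
  (1 - d) ^ n - ∑ i ∈ Finset.range (m + 1), rmCoeff n d i

/-- The denominator `a_0 + a_1 ω + ⋯ + a_{m+1} ω^{m+1}` of the WENO-RM(mn0) mapping. -/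
def rmDenom (m n : ℕ) (d ω : ℝ) : ℝ :=
  (∑ i ∈ Finset.range (m + 1), rmCoeff n d i * ω ^ i) + rmLastCoeff m n d * ω ^ (m + 1)

/-- The WENO-RM(mn0) mapping function with parameter `d`. -/
def rmMap (m n : ℕ) (d ω : ℝ) : ℝ :=
  d + (ω - d) ^ (n + 1) / rmDenom m n d ω

/-- The rational mapping functions `(g^RM)_s`, `s = 0, …, r - 1`, are defined on all of `[0, 1]`. -/
def RMWellDefined (r m n : ℕ) : Prop :=
  ∀ s < r, ∀ ω ∈ Set.Icc (0 : ℝ) 1, rmDenom m n (idealWeight r s) ω ≠ 0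

/-- The index `k^*`: the smallest index at which `|ω - d_i|`, `0 ≤ i ≤ r - 1`, is minimal. -/
def minDistIndex (r : ℕ) (d : ℕ → ℝ) (ω : ℝ) : ℕ :=
  sInf {k : ℕ | k < r ∧ ∀ i < r, |ω - d k| ≤ |ω - d i|}

/-- The function `minDist(x_0, …, x_{r-1}; d_0, …, d_{r-1}; ω)`. -/
def minDist (r : ℕ) (x d : ℕ → ℝ) (ω : ℝ) : ℝ := x (minDistIndex r d ω)

/-- The order-preserving mapping `g^{MOP-RM}`: the WENO-RM(mn0) mapping whose parameter `d_s` is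
replaced by the ideal weight selected by `minDist`. -/
def mopMap (r m n : ℕ) (ω : ℝ) : ℝ :=
  rmMap m n (minDist r (idealWeight r) (idealWeight r) ω) ω

/-- The unnormalized MOP-WENO-RM(mn0) weights. -/
def alphaMOP (r m n : ℕ) (ε : ℝ) (v : ℤ → ℝ) (s : ℕ) : ℝ :=
  mopMap r m n (omegaJS r ε v s)

/-- The nonlinear MOP-WENO-RM(mn0) weights. -/
def omegaMOP (r m n : ℕ) (ε : ℝ) (v : ℤ → ℝ) (s : ℕ) : ℝ :=
  alphaMOP r m n ε v s / ∑ l ∈ Finset.range r, alphaMOP r m n ε v l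

/-- The MOP-WENO-RM(mn0) reconstruction at the right boundary of cell `0`, biased to the left. -/
def mopRecon (r m n : ℕ) (ε : ℝ) (v : ℤ → ℝ) : ℝ :=
  ∑ s ∈ Finset.range r, omegaMOP r m n ε v s * subRecon r s v

/-- The left-biased value `u^-_{j+1/2}`. -/
def uMinus (r m n : ℕ) (ε : ℝ) (v : ℤ → ℝ) (j : ℤ) : ℝ :=
  mopRecon r m n ε (fun i => v (j + i))

/-- The right-biased value `u^+_{j+1/2}`: mirror image of the left-biased reconstruction with respect
to `x_{j+1/2}`. -/
def uPlus (r m n : ℕ) (ε : ℝ) (v : ℤ → ℝ) (j : ℤ) : ℝ :=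
  mopRecon r m n ε (fun i => v (j + 1 - i))

/-- The Lax–Friedrichs flux with viscosity constant `α`. -/
def lxfFlux (f : ℝ → ℝ) (α a b : ℝ) : ℝ := (1 / 2) * (f a + f b - α * (b - a))

/-- The numerical flux at `x_{j+1/2}`. -/
def numFlux (r m n : ℕ) (ε : ℝ) (f : ℝ → ℝ) (α : ℝ) (v : ℤ → ℝ) (j : ℤ) : ℝ :=
  lxfFlux f α (uMinus r m n ε v j) (uPlus r m n ε v j)

/-- The right-hand side `L(u_j) = -(1/Δx) (f̂_{j+1/2} - f̂_{j-1/2})` of the semi-discrete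
MOP-WENO-RM(mn0) finite volume scheme with cell size `h`. -/
def semiDiscrete (r m n : ℕ) (ε : ℝ) (f : ℝ → ℝ) (α h : ℝ) (v : ℤ → ℝ) (j : ℤ) : ℝ :=
  -(1 / h) * (numFlux r m n ε f α v j - numFlux r m n ε f α v (j - 1))

/-- The average of `u` over the cell with centre `x + i h` and size `h`. -/
def cellAverage (u : ℝ → ℝ) (x h : ℝ) (i : ℤ) : ℝ :=
  (1 / h) * ∫ y in (x + ((i : ℝ) - 1 / 2) * h)..(x + ((i : ℝ) + 1 / 2) * h), u y

/-- `x₀` is a critical point of `u` of order `k`: `u' = ⋯ = u^{(k)} = 0` and `u^{(k+1)} ≠ 0`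
at `x₀`. -/
def IsCriticalPointOfOrder (u : ℝ → ℝ) (x₀ : ℝ) (k : ℕ) : Prop :=
  (∀ i, 1 ≤ i → i ≤ k → iteratedDeriv i u x₀ = 0) ∧ iteratedDeriv (k + 1) u x₀ ≠ 0

/-- The ideal weights lie strictly between `0` and `1`. -/
theorem idealWeight_mem_Ioo {r s : ℕ} (hr : 2 ≤ r) (hs : s < r) :
    idealWeight r s ∈ Set.Ioo (0 : ℝ) 1 := by
  have hC : 0 < (2 * r - 1).choose r := Nat.choose_pos (by omega)
  have h1 : 0 < r.choose s := Nat.choose_pos hs.le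
  have h2 : 0 < (r - 1).choose s := Nat.choose_pos (by omega)
  refine ⟨by unfold idealWeight; positivity, ?_⟩
  unfold idealWeight
  rw [div_lt_one (by exact_mod_cast hC)]
  norm_cast
  obtain ⟨t, htr, hts⟩ : ∃ t, t < r ∧ t ≠ s := by
    by_cases h : s = 0
    · exact ⟨1, by omega, by omega⟩
    · exact ⟨0, by omega, by omega⟩
  have h3 : 0 < r.choose t := Nat.choose_pos htr.le
  have h4 : 0 < (r - 1).choose t := Nat.choose_pos (by omega)
  have key := Nat.add_choose_eq r (r - 1) r
  rw [show r + (r - 1) = 2 * r - 1 by omega] at key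
  have hsub : ({(r - s, s), (r - t, t)} : Finset (ℕ × ℕ)) ⊆ Finset.HasAntidiagonal.antidiagonal r := by
    intro p hp
    simp only [Finset.mem_insert, Finset.mem_singleton] at hp
    rw [Finset.HasAntidiagonal.mem_antidiagonal]
    rcases hp with rfl | rfl <;> simp only <;> omega
  have hle := Finset.sum_le_sum_of_subset (f := fun p : ℕ × ℕ => r.choose p.1 * (r - 1).choose p.2) hsub
  rw [Finset.sum_pair (by simp only [ne_eq, Prod.mk.injEq, not_and]; omega), ← key,
    Nat.choose_symm hs.le, Nat.choose_symm htr.le] at hle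
  dsimp only at hle
  have := Nat.mul_pos h3 h4
  omega

/-- The recommended mapping with `m = 2`, `n = 6` is defined on `[0, 1]`. -/
theorem rmWellDefined_two_six {r : ℕ} (hr : 2 ≤ r) : RMWellDefined r 2 6 := by
  intro s hs w hw
  obtain ⟨hd, hd1⟩ := idealWeight_mem_Ioo hr hs
  obtain ⟨hw, hw1⟩ := hw
  generalize idealWeight r s = d at hd hd1
  have e : rmDenom 2 6 d w = d ^ 4 * ((1 - w) * (d ^ 2 * (1 + w + w ^ 2)
      - 7 * d * (w * (1 + w)) + 21 * w ^ 2)) + (1 - d) ^ 6 * w ^ 3 := by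
    simp [rmDenom, rmLastCoeff, rmCoeff, Finset.sum_range_succ, Nat.choose]; ring
  have hq : 0 < d ^ 2 * (1 + w + w ^ 2) - 7 * d * (w * (1 + w)) + 21 * w ^ 2 := by
    have hS : 0 < 1 + w + w ^ 2 := by positivity
    have h5 : 0 ≤ w ^ 2 * (35 - 14 * w + 35 * w ^ 2) := by
      have : 0 ≤ 35 - 14 * w + 35 * w ^ 2 := by nlinarith
      positivity
    rcases hw.eq_or_lt with rfl | hw0
    · simp; positivity
    · have h6 : 0 < w ^ 2 * (35 - 14 * w + 35 * w ^ 2) := by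
        have : 0 < 35 - 14 * w + 35 * w ^ 2 := by nlinarith
        positivity
      by_contra hneg
      have := mul_le_mul_of_nonneg_left (not_lt.mp hneg) hS.le
      nlinarith [sq_nonneg (2 * d * (1 + w + w ^ 2) - 7 * (w * (1 + w)))]
  rw [e]
  rcases hw.eq_or_lt with rfl | hw0
  · have : 0 < d ^ 4 * ((1 - 0) * (d ^ 2 * (1 + 0 + 0 ^ 2) - 7 * d * (0 * (1 + 0)) + 21 * 0 ^ 2)) := by
      positivity
    simp; positivity
  · have h7 : 0 < (1 - d) ^ 6 * w ^ 3 := by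
      have : 0 < 1 - d := by linarith
      positivity
    have h8 : 0 ≤ d ^ 4 * ((1 - w) * (d ^ 2 * (1 + w + w ^ 2)
      - 7 * d * (w * (1 + w)) + 21 * w ^ 2)) :=
      mul_nonneg (by positivity) (mul_nonneg (by linarith) hq.le)
    linarith

end MOPWENO

end

open MOPWENO Polynomial

/-! In the scaled coordinate the data are the unit-cell averages of `ξ ↦ u (x + h ξ)`. Put `j = ncp
+ 1 < r`, so that the `j`-th derivative of `u` is bounded away from zero near `x₀`.

Nonlinear weights. All substencil polynomials, with their derivatives, differ on the reference cell
by `O(h^r)` from one Taylor polynomial `T` of degree at most `r - 1`. Its smoothness functional `B`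
is at least a constant times `h^(2j)`. Hence every indicator is `B (1 + O(h^(r-j)))`
(`exists_bound_smoothnessIndicator_sub`) and the Jiang–Shu weights are within `O(h^(r-j))` of the
ideal ones. This is uniform in `ε ≥ 0`, since adding `ε` to the indicators and to `B` only lowers
the relative error. Near an ideal weight the order-preserving map selects that very value as its
parameter and is flat there to order `n`, so the mapped weights err by `O(h^((r-j)(n+1)))`. The
hypothesis on `n` says exactly `(r-j)(n+1) ≥ r`. Weight errors `O(h^r)` multiply substencil errors
`O(h^r)`, so the nonlinear and the linear reconstruction differ by `O(h^(2r))`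
(`exists_bound_mopRecon_sub`).

Linear reconstruction. It is exact up to degree `2r - 2`: a Neville recursion at a shared node
yields the ideal weights as a hypergeometric distribution (`choose_mul_stencilDeriv`). Its error is
therefore `O(h^(2r-1))`.

Flux difference. Division by `h` would cost an order, so the errors at the two cell boundaries must
agree up to `O(h^(2r))`. The linear error does, being Lipschitz in the cell centre with constant
`O(h^(2r-1))` (`exists_bound_linError_affine`); the nonlinear remainder is already of that order. A
`C²` flux preserves this near-cancellation. The right-biased values are the left-biased ones with
`h` replaced by `-h`. -/

/-! ### Reconstruction polynomials and primitives -/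

/-- The average of `w` over the unit cell with centre `i`. -/
noncomputable def unitAverage (w : ℝ → ℝ) (i : ℤ) : ℝ :=
  ∫ ξ in ((i : ℝ) - 1 / 2)..((i : ℝ) + 1 / 2), w ξ

theorem Polynomial.exists_derivative_eq (P : ℝ[X]) :
    ∃ Q : ℝ[X], derivative Q = P ∧ ∀ k : ℕ, P.degree < k → Q.degree < (k + 1 : ℕ) := by
  refine ⟨∑ i ∈ Finset.range (P.natDegree + 1), C (P.coeff i / (i + 1)) * X ^ (i + 1), ?_, ?_⟩
  · conv_rhs => rw [P.as_sum_range_C_mul_X_pow]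
    rw [derivative_sum]
    refine Finset.sum_congr rfl fun i _ => ?_
    rw [derivative_C_mul_X_pow]
    have : (i : ℝ) + 1 ≠ 0 := by positivity
    simp only [Nat.add_sub_cancel]
    congr 2
    push_cast
    field_simp
  · intro k hk
    rw [degree_lt_iff_coeff_zero] at hk ⊢
    intro j hj
    rw [finsetSum_coeff]
    refine Finset.sum_eq_zero fun i _ => ?_
    rw [coeff_C_mul_X_pow]
    split_ifs with h
    · rw [hk i (by omega), zero_div]
    · rfl

theorem Polynomial.integral_eval_derivative (Q : ℝ[X]) (a b : ℝ) :
    ∫ x in a..b, (derivative Q).eval x = Q.eval b - Q.eval a :=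
  intervalIntegral.integral_eq_sub_of_hasDerivAt (fun x _ => Q.hasDerivAt x)
    ((derivative Q).continuous.intervalIntegrable _ _)

theorem injOn_reconNodes (a : ℤ) (S : Set ℕ) :
    Set.InjOn (fun i : ℕ => (a : ℝ) + (i : ℝ) - 1 / 2) S := by
  intro i _ j _ h
  have : (i : ℝ) = j := by simp only at h; linarith
  exact_mod_cast this

/-- If the data are increments of `Q` over the cells and `Q` has degree at most `k`, the
reconstruction is the derivative of `Q`. -/
theorem reconPoly_eq_derivative (a : ℤ) (k : ℕ) (v : ℤ → ℝ) (Q : ℝ[X]) (hQ : Q.degree < (k + 1 : ℕ))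
    (hv : ∀ i < k, v (a + (i : ℤ)) =
      Q.eval ((a : ℝ) + ((i + 1 : ℕ) : ℝ) - 1 / 2) - Q.eval ((a : ℝ) + (i : ℝ) - 1 / 2)) :
    reconPoly a k v = derivative Q := by
  unfold reconPoly
  -- The primitive inside `reconPoly` is zero at the leftmost boundary, so `Q` is normalised by a
  -- constant, which the derivative forgets.
  rw [← Lagrange.eq_interpolate_of_eval_eq (f := Q - C (Q.eval ((a : ℝ) + ((0 : ℕ) : ℝ) - 1 / 2)))
    _ (injOn_reconNodes a _)]
  · simp
  · rw [Finset.card_range, sub_eq_add_neg, ← C_neg]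
    refine lt_of_le_of_lt (degree_add_le _ _) (max_lt hQ (lt_of_le_of_lt degree_C_le ?_))
    exact_mod_cast Nat.succ_pos k
  · intro i hi
    rw [Finset.mem_range] at hi
    rw [eval_sub, eval_C, ← Finset.sum_range_sub (fun i : ℕ => Q.eval ((a : ℝ) + (i : ℝ) - 1 / 2))]
    refine Finset.sum_congr rfl fun j hj => ?_
    rw [Finset.mem_range] at hj
    exact (hv j (by omega)).symm

theorem reconPoly_unitAverage (a : ℤ) (k : ℕ) (P : ℝ[X]) (hP : P.degree < k) :
    reconPoly a k (unitAverage fun ξ => P.eval ξ) = P := by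
  obtain ⟨Q, rfl, hdeg⟩ := P.exists_derivative_eq
  refine reconPoly_eq_derivative a k _ Q (hdeg k hP) fun i _ => ?_
  rw [unitAverage, Polynomial.integral_eval_derivative]
  push_cast
  congr 2 <;> ring

theorem reconPoly_sub (a : ℤ) (k : ℕ) (v w : ℤ → ℝ) :
    reconPoly a k (fun i => v i - w i) = reconPoly a k v - reconPoly a k w := by
  unfold reconPoly
  rw [← derivative_sub, ← map_sub]
  congr 2
  ext i
  simp [Finset.sum_sub_distrib]

/-- Derivatives of the reconstruction on the reference cell are bounded by the data. -/
theorem exists_bound_iterate_derivative_reconPoly (a : ℤ) (k l : ℕ) :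
    ∃ K : ℝ, 0 ≤ K ∧ ∀ (v : ℤ → ℝ) (η : ℝ), (∀ j < k, |v (a + (j : ℤ))| ≤ η) →
      ∀ ξ ∈ Set.Icc (-(1 / 2) : ℝ) (1 / 2), |(derivative^[l] (reconPoly a k v)).eval ξ| ≤ K * η := by
  set b : ℕ → ℝ[X] := fun i => derivative^[l] (derivative
    (Lagrange.basis (Finset.range (k + 1)) (fun i : ℕ => (a : ℝ) + (i : ℝ) - 1 / 2) i)) with hb
  have hbd : ∀ i, ∃ M : ℝ, 0 ≤ M ∧ ∀ ξ ∈ Set.Icc (-(1 / 2) : ℝ) (1 / 2), |(b i).eval ξ| ≤ M := by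
    intro i
    obtain ⟨M, hM⟩ := (isCompact_Icc (a := (-(1 / 2) : ℝ)) (b := 1 / 2)).exists_bound_of_continuousOn
      (b i).continuous.continuousOn
    exact ⟨max M 0, le_max_right _ _, fun ξ hξ => (hM ξ hξ).trans (le_max_left _ _)⟩
  choose M hM0 hM using hbd
  -- The factor `i` counts the data summed in the primitive at the `i`-th boundary.
  refine ⟨∑ i ∈ Finset.range (k + 1), i * M i,
    Finset.sum_nonneg fun i _ => mul_nonneg i.cast_nonneg (hM0 i), fun v η hv ξ hξ => ?_⟩
  have e : derivative^[l] (reconPoly a k v) =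
      ∑ i ∈ Finset.range (k + 1), C (∑ j ∈ Finset.range i, v (a + (j : ℤ))) * b i := by
    rw [reconPoly, Lagrange.interpolate_apply, derivative_sum, iterate_derivative_sum]
    refine Finset.sum_congr rfl fun i _ => ?_
    rw [derivative_C_mul, iterate_derivative_C_mul]
  rw [e, eval_finsetSum, Finset.sum_mul]
  refine (Finset.abs_sum_le_sum_abs _ _).trans (Finset.sum_le_sum fun i hi => ?_)
  rw [Finset.mem_range] at hi
  rw [eval_mul, eval_C, abs_mul]
  have h1 : |∑ j ∈ Finset.range i, v (a + (j : ℤ))| ≤ i * η := by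
    refine (Finset.abs_sum_le_sum_abs _ _).trans ?_
    refine (Finset.sum_le_sum (g := fun _ => η) fun j hj => ?_).trans (by simp)
    rw [Finset.mem_range] at hj
    exact hv j (by omega)
  calc _ ≤ (i * η) * M i :=
        mul_le_mul h1 (hM i ξ hξ) (abs_nonneg _) ((abs_nonneg _).trans h1)
    _ = i * M i * η := by ring

/-! ### Ideal weights from the Neville recursion -/

/-- The derivative at `1/2` of the polynomial that interpolates `Q` at the half-integers
`-a + 1/2, …, b + 1/2`. -/
noncomputable def stencilDeriv (Q : ℝ[X]) (a b : ℕ) : ℝ :=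
  (derivative (Lagrange.interpolate (Finset.Icc (-(a : ℤ)) b) (fun z : ℤ => (z : ℝ) + 1 / 2)
    (fun z : ℤ => Q.eval ((z : ℝ) + 1 / 2)))).eval (1 / 2)

theorem injOn_halfIntegers (S : Set ℤ) : Set.InjOn (fun z : ℤ => (z : ℝ) + 1 / 2) S := by
  intro i _ j _ h
  have : (i : ℝ) = j := by simp only at h; linarith
  exact_mod_cast this

theorem stencilDeriv_of_degree_lt (Q : ℝ[X]) (a b : ℕ) (hQ : Q.degree < (a + b + 1 : ℕ)) :
    stencilDeriv Q a b = (derivative Q).eval (1 / 2) := by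
  unfold stencilDeriv
  rw [← Lagrange.eq_interpolate_of_eval_eq (f := Q) _ (injOn_halfIntegers _) _ fun _ _ => rfl]
  rw [Int.card_Icc]
  convert hQ using 2
  omega

/-- The Aitken–Neville recursion for the derivative at a node. -/
theorem stencilDeriv_succ_succ (Q : ℝ[X]) (a b : ℕ) :
    ((a : ℝ) + b + 2) * stencilDeriv Q (a + 1) (b + 1) =
      (a + 1) * stencilDeriv Q a (b + 1) + (b + 1) * stencilDeriv Q (a + 1) b := by
  have hpos : (a : ℝ) + b + 2 ≠ 0 := by positivity
  have e1 : (Finset.Icc (-((a + 1 : ℕ) : ℤ)) ((b + 1 : ℕ) : ℤ)).erase ((b + 1 : ℕ) : ℤ) =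
      Finset.Icc (-((a + 1 : ℕ) : ℤ)) (b : ℤ) := by
    ext z; simp only [Finset.mem_erase, Finset.mem_Icc]; omega
  have e2 : (Finset.Icc (-((a + 1 : ℕ) : ℤ)) ((b + 1 : ℕ) : ℤ)).erase (-((a + 1 : ℕ) : ℤ)) =
      Finset.Icc (-(a : ℤ)) ((b + 1 : ℕ) : ℤ) := by
    ext z; simp only [Finset.mem_erase, Finset.mem_Icc]; omega
  -- The node `1/2` (index `0`) belongs to both smaller stencils. Both interpolants equal `Q(1/2)`
  -- there, so in the product rule the terms with differentiated divisors have opposite coefficients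
  -- and cancel.
  have hnode : ∀ c d : ℕ, (Lagrange.interpolate (Finset.Icc (-(c : ℤ)) d)
      (fun z : ℤ => (z : ℝ) + 1 / 2) (fun z : ℤ => Q.eval ((z : ℝ) + 1 / 2))).eval (1 / 2) =
      Q.eval (1 / 2) := by
    intro c d
    have := Lagrange.eval_interpolate_at_node (s := Finset.Icc (-(c : ℤ)) d) (i := 0)
      (v := fun z : ℤ => (z : ℝ) + 1 / 2) (fun z : ℤ => Q.eval ((z : ℝ) + 1 / 2))
      (injOn_halfIntegers _) (by simp)
    simpa using this
  conv_lhs => rw [stencilDeriv]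
  rw [Lagrange.interpolate_eq_add_interpolate_erase (i := -((a + 1 : ℕ) : ℤ))
    (j := ((b + 1 : ℕ) : ℤ)) _ (injOn_halfIntegers _) (by simp only [Finset.mem_Icc]; omega)
    (by simp only [Finset.mem_Icc]; omega) (by omega), e1, e2, derivative_add, derivative_mul,
    derivative_mul, eval_add, eval_add, eval_add, eval_mul, eval_mul, eval_mul, eval_mul,
    hnode, hnode, ← stencilDeriv, ← stencilDeriv]
  simp only [Lagrange.basisDivisor, derivative_C_mul, derivative_X_sub_C, mul_one, eval_C,
    eval_mul, eval_sub, eval_X]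
  push_cast
  have h1 : (-((a : ℝ) + 1) + 1 / 2 - ((b : ℝ) + 1 + 1 / 2))⁻¹ = -((a : ℝ) + b + 2)⁻¹ := by
    rw [← inv_neg]; congr 1; ring
  have h2 : ((b : ℝ) + 1 + 1 / 2 - (-((a : ℝ) + 1) + 1 / 2))⁻¹ = ((a : ℝ) + b + 2)⁻¹ := by
    congr 1; ring
  rw [h1, h2]
  field_simp
  ring

/-- The derivative on a large stencil as a hypergeometric mean of derivatives on substencils. -/
theorem choose_mul_stencilDeriv (Q : ℝ[X]) (k a b : ℕ) (ha : k ≤ a) (hb : k ≤ b) :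
    ((a + b).choose k : ℝ) * stencilDeriv Q a b =
      ∑ i ∈ Finset.range (k + 1),
        (a.choose i : ℝ) * (b.choose (k - i) : ℝ) * stencilDeriv Q (a - i) (b - (k - i)) := by
  induction k generalizing a b with
  | zero => simp
  | succ k ih =>
    obtain ⟨a, rfl⟩ : ∃ c, a = c + 1 := ⟨a - 1, by omega⟩
    obtain ⟨b, rfl⟩ : ∃ c, b = c + 1 := ⟨b - 1, by omega⟩
    have hk : ((k : ℝ) + 1) ≠ 0 := by positivity
    have hch : (((a + 1 + (b + 1)).choose (k + 1) : ℕ) : ℝ) * (k + 1) =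
        ((a : ℝ) + b + 2) * ((a + (b + 1)).choose k : ℕ) := by
      have := Nat.add_one_mul_choose_eq (a + (b + 1)) k
      rw [show a + (b + 1) + 1 = a + 1 + (b + 1) by ring] at this
      have h2 := congrArg (Nat.cast : ℕ → ℝ) this
      push_cast at h2 ⊢
      linarith
    have ih1 := ih a (b + 1) (by omega) (by omega)
    have ih2 := ih (a + 1) b (by omega) (by omega)
    rw [show a + 1 + b = a + (b + 1) by ring] at ih2
    -- By absorption, `(a+1) C(a,i) = (i+1) C(a+1,i+1)`, both halves of the recursion become the
    -- same sum, weighted by `i` here and by `k + 1 - i` in `B`; the two weights add up to `k + 1`.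
    have A : ((a : ℝ) + 1) * (((a + (b + 1)).choose k : ℝ) * stencilDeriv Q a (b + 1)) =
        ∑ i ∈ Finset.range (k + 1 + 1), (i : ℝ) * (((a + 1).choose i : ℝ) *
          ((b + 1).choose (k + 1 - i) : ℝ) * stencilDeriv Q (a + 1 - i) (b + 1 - (k + 1 - i))) := by
      rw [ih1, Finset.sum_range_succ' _ (k + 1), Finset.mul_sum]
      simp only [Nat.cast_zero, zero_mul, add_zero]
      refine Finset.sum_congr rfl fun i _ => ?_
      have h := congrArg (Nat.cast : ℕ → ℝ) (Nat.add_one_mul_choose_eq a i)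
      push_cast at h
      rw [Nat.add_sub_add_right, Nat.add_sub_add_right]
      push_cast
      linear_combination (((b + 1).choose (k - i) : ℝ) *
        stencilDeriv Q (a - i) (b + 1 - (k - i))) * h
    have B : ((b : ℝ) + 1) * (((a + (b + 1)).choose k : ℝ) * stencilDeriv Q (a + 1) b) =
        ∑ i ∈ Finset.range (k + 1 + 1), ((k : ℝ) + 1 - i) * (((a + 1).choose i : ℝ) *
          ((b + 1).choose (k + 1 - i) : ℝ) * stencilDeriv Q (a + 1 - i) (b + 1 - (k + 1 - i))) := by
      rw [ih2, Finset.sum_range_succ _ (k + 1), Finset.mul_sum]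
      push_cast
      simp only [sub_self, zero_mul, add_zero]
      refine Finset.sum_congr rfl fun i hi => ?_
      rw [Finset.mem_range] at hi
      have h := congrArg (Nat.cast : ℕ → ℝ) (Nat.add_one_mul_choose_eq b (k - i))
      push_cast [Nat.cast_sub (show i ≤ k by omega)] at h
      rw [show k + 1 - i = k - i + 1 by omega, Nat.add_sub_add_right]
      linear_combination (((a + 1).choose i : ℝ) *
        stencilDeriv Q (a + 1 - i) (b - (k - i))) * h
    have N := stencilDeriv_succ_succ Q a b
    have S : ((k : ℝ) + 1) * ∑ i ∈ Finset.range (k + 1 + 1), (((a + 1).choose i : ℝ) *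
          ((b + 1).choose (k + 1 - i) : ℝ) * stencilDeriv Q (a + 1 - i) (b + 1 - (k + 1 - i))) =
        ((a : ℝ) + 1) * (((a + (b + 1)).choose k : ℝ) * stencilDeriv Q a (b + 1)) +
        ((b : ℝ) + 1) * (((a + (b + 1)).choose k : ℝ) * stencilDeriv Q (a + 1) b) := by
      rw [A, B, Finset.mul_sum, ← Finset.sum_add_distrib]
      exact Finset.sum_congr rfl fun i _ => by ring
    apply mul_left_cancel₀ hk
    rw [S]
    linear_combination stencilDeriv Q (a + 1) (b + 1) * hch +
      ((a + (b + 1)).choose k : ℝ) * N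

/-- The boundaries of the substencil run from `s - r + 1/2` to `s + 1/2`: `r - s` nodes to the left
of `1/2` and `s` to its right. -/
theorem subRecon_unitAverage (r s : ℕ) (hs : s < r) (Q : ℝ[X]) :
    subRecon r s (unitAverage fun ξ => (derivative Q).eval ξ) = stencilDeriv Q (r - s) s := by
  unfold subRecon subPoly stencilDeriv
  set I := Lagrange.interpolate (Finset.Icc (-((r - s : ℕ) : ℤ)) s) (fun z : ℤ => (z : ℝ) + 1 / 2)
    (fun z : ℤ => Q.eval ((z : ℝ) + 1 / 2)) with hI
  have hnode : ∀ i : ℕ, i < r + 1 → I.eval ((((s : ℤ) - r + 1 : ℤ) : ℝ) + (i : ℝ) - 1 / 2) =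
      Q.eval ((((s : ℤ) - r + 1 : ℤ) : ℝ) + (i : ℝ) - 1 / 2) := by
    intro i hi
    have := Lagrange.eval_interpolate_at_node (s := Finset.Icc (-((r - s : ℕ) : ℤ)) (s : ℤ))
      (i := (s : ℤ) - r + i) (v := fun z : ℤ => (z : ℝ) + 1 / 2)
      (fun z : ℤ => Q.eval ((z : ℝ) + 1 / 2)) (injOn_halfIntegers _)
      (by simp only [Finset.mem_Icc]; omega)
    rw [← hI] at this
    push_cast at this ⊢
    convert this using 2 <;> ring
  rw [reconPoly_eq_derivative _ _ _ I]
  · refine (Lagrange.degree_interpolate_lt _ (injOn_halfIntegers _)).trans_le ?_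
    rw [Int.card_Icc]
    norm_cast
    omega
  · intro i hi
    rw [hnode i (by omega), hnode (i + 1) (by omega), unitAverage,
      Polynomial.integral_eval_derivative]
    push_cast
    congr 2 <;> ring

/-- The ideal weights make the combination of the substencil values exact on polynomials of degree
at most `2 r - 2`. -/
theorem sum_idealWeight_mul_subRecon (r : ℕ) (hr : 1 ≤ r) (P : ℝ[X])
    (hP : P.degree < (2 * r - 1 : ℕ)) :
    ∑ s ∈ Finset.range r, idealWeight r s * subRecon r s (unitAverage fun ξ => P.eval ξ) =
      P.eval (1 / 2) := by
  obtain ⟨Q, rfl, hdeg⟩ := P.exists_derivative_eq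
  have hQ := hdeg _ hP
  -- The full stencil has `r` boundaries to the left of `1/2` and `r - 1` to the right; dropping `r
  -- - 1` of these `2r - 1` leaves exactly the substencils.
  have h := choose_mul_stencilDeriv Q (r - 1) r (r - 1) (by omega) le_rfl
  rw [stencilDeriv_of_degree_lt Q r (r - 1) (by convert hQ using 2; omega),
    Nat.sub_add_cancel hr, show r + (r - 1) = 2 * r - 1 by omega] at h
  have hc : (2 * r - 1).choose (r - 1) = (2 * r - 1).choose r :=
    Nat.choose_symm_of_eq_add (by omega)
  rw [hc] at h
  have hne : ((2 * r - 1).choose r : ℝ) ≠ 0 := by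
    exact_mod_cast (Nat.choose_pos (by omega)).ne'
  rw [← mul_right_inj' hne, h, Finset.mul_sum]
  refine Finset.sum_congr rfl fun s hs => ?_
  rw [Finset.mem_range] at hs
  rw [subRecon_unitAverage r s hs, idealWeight, show r - 1 - (r - 1 - s) = s by omega,
    Nat.choose_symm (show s ≤ r - 1 by omega)]
  field_simp

theorem sum_idealWeight (r : ℕ) (hr : 1 ≤ r) : ∑ s ∈ Finset.range r, idealWeight r s = 1 := by
  have h := sum_idealWeight_mul_subRecon r hr 1 (by
    rw [degree_one]; exact_mod_cast (by omega : 0 < 2 * r - 1))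
  rw [eval_one] at h
  rw [← h]
  refine Finset.sum_congr rfl fun s _ => ?_
  rw [subRecon, subPoly, reconPoly_unitAverage _ _ _ (by rw [degree_one]; exact_mod_cast hr),
    eval_one, mul_one]

/-! ### Taylor polynomials -/

/-- The Taylor polynomial of `w` of degree `k` at `a`. -/
noncomputable def taylorPoly (w : ℝ → ℝ) (k : ℕ) (a : ℝ) : ℝ[X] :=
  ∑ i ∈ Finset.range (k + 1), C (iteratedDeriv i w a / (i.factorial : ℝ)) * (X - C a) ^ i

theorem degree_taylorPoly_lt (w : ℝ → ℝ) (k : ℕ) (a : ℝ) :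
    (taylorPoly w k a).degree < (k + 1 : ℕ) := by
  refine (degree_sum_le _ _).trans_lt ((Finset.sup_lt_iff (WithBot.bot_lt_coe _)).2 fun i hi => ?_)
  rw [Finset.mem_range] at hi
  refine (degree_mul_le _ _).trans_lt ((add_le_add_left degree_C_le _).trans_lt ?_)
  rw [zero_add, degree_pow, degree_X_sub_C, nsmul_one]
  exact_mod_cast hi

theorem derivative_taylorPoly_succ (w : ℝ → ℝ) (k : ℕ) (a : ℝ) :
    derivative (taylorPoly w (k + 1) a) = taylorPoly (deriv w) k a := by
  rw [taylorPoly, Finset.sum_range_succ', derivative_add, derivative_sum, taylorPoly]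
  simp only [pow_zero, mul_one, derivative_C, add_zero]
  refine Finset.sum_congr rfl fun i _ => ?_
  rw [derivative_C_mul, derivative_X_sub_C_pow, iteratedDeriv_succ', Nat.add_sub_cancel,
    ← mul_assoc, ← C_mul]
  congr 2
  have h1 : ((i : ℝ) + 1) ≠ 0 := by positivity
  have h2 : (i.factorial : ℝ) ≠ 0 := by positivity
  rw [Nat.factorial_succ]
  push_cast
  field_simp

theorem iterate_derivative_taylorPoly (w : ℝ → ℝ) (k j : ℕ) (a : ℝ) :
    derivative^[j] (taylorPoly w (k + j) a) = taylorPoly (iteratedDeriv j w) k a := by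
  induction j generalizing w with
  | zero => simp
  | succ j ih =>
    rw [Function.iterate_succ_apply, ← add_assoc, derivative_taylorPoly_succ, ih,
      ← iteratedDeriv_succ']

theorem eval_taylorPoly (w : ℝ → ℝ) (k : ℕ) (a ξ : ℝ) :
    (taylorPoly w k a).eval ξ =
      ∑ i ∈ Finset.range (k + 1), iteratedDeriv i w a / (i.factorial : ℝ) * (ξ - a) ^ i := by
  simp [taylorPoly, eval_finsetSum]

theorem abs_sub_taylorPoly_le {w : ℝ → ℝ} {k : ℕ} {a b M ξ : ℝ} (hab : a < b)
    (hw : ContDiff ℝ (k + 1 : ℕ) w) (hM : ∀ y ∈ Set.Icc a b, |iteratedDeriv (k + 1) w y| ≤ M)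
    (hξ : ξ ∈ Set.Icc a b) :
    |w ξ - (taylorPoly w k a).eval ξ| ≤ (b - a) ^ (k + 1) * M := by
  have hM0 : 0 ≤ M := (abs_nonneg _).trans (hM ξ hξ)
  have hu := uniqueDiffOn_Icc hab
  have key := taylor_mean_remainder_bound (n := k) hab.le (by exact_mod_cast hw.contDiffOn) hξ
    (C := M) (fun y hy => by
      rw [iteratedDerivWithin_eq_iteratedDeriv hu hw.contDiffAt hy]; exact hM y hy)
  have e : taylorWithinEval w k (Set.Icc a b) a ξ = (taylorPoly w k a).eval ξ := by
    rw [taylor_within_apply, eval_taylorPoly]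
    refine Finset.sum_congr rfl fun i hi => ?_
    rw [Finset.mem_range] at hi
    rw [iteratedDerivWithin_eq_iteratedDeriv hu
      ((hw.of_le (by exact_mod_cast hi.le)).contDiffAt) ⟨le_rfl, hab.le⟩, smul_eq_mul]
    ring
  rw [e, Real.norm_eq_abs] at key
  refine key.trans ?_
  have h1 : (ξ - a) ^ (k + 1) ≤ (b - a) ^ (k + 1) :=
    pow_le_pow_left₀ (by linarith [hξ.1]) (by linarith [hξ.2]) _
  have h2 : (1 : ℝ) ≤ k.factorial := by exact_mod_cast k.factorial_pos
  have h3 : 0 ≤ (ξ - a) ^ (k + 1) := pow_nonneg (by linarith [hξ.1]) _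
  calc _ ≤ M * (ξ - a) ^ (k + 1) := div_le_self (mul_nonneg hM0 h3) h2
    _ ≤ _ := by rw [mul_comm]; exact mul_le_mul_of_nonneg_right h1 hM0

/-! ### Cell averages: scaling, reflection, continuous dependence -/

theorem unitAverage_sub {w z : ℝ → ℝ} (hw : Continuous w) (hz : Continuous z) (i : ℤ) :
    unitAverage (fun ξ => w ξ - z ξ) i = unitAverage w i - unitAverage z i :=
  intervalIntegral.integral_sub (hw.intervalIntegrable _ _) (hz.intervalIntegrable _ _)

theorem abs_unitAverage_le {w : ℝ → ℝ} {i : ℤ} {η : ℝ}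
    (h : ∀ ξ ∈ Set.Icc ((i : ℝ) - 1 / 2) (i + 1 / 2), |w ξ| ≤ η) : |unitAverage w i| ≤ η := by
  have := intervalIntegral.norm_integral_le_of_norm_le_const (f := w) (C := η)
    (a := (i : ℝ) - 1 / 2) (b := i + 1 / 2) (fun ξ hξ => by
      rw [Set.uIoc_of_le (by linarith)] at hξ
      exact h ξ ⟨hξ.1.le, hξ.2⟩)
  rw [Real.norm_eq_abs, show (i : ℝ) + 1 / 2 - (i - 1 / 2) = 1 by ring, abs_one, mul_one] at this
  exact this

theorem cellAverage_eq_unitAverage (u : ℝ → ℝ) (x : ℝ) {h : ℝ} (hh : h ≠ 0) :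
    cellAverage u x h = unitAverage fun ξ => u (x + h * ξ) := by
  ext i
  rw [cellAverage, unitAverage, intervalIntegral.integral_comp_add_mul u hh x, smul_eq_mul,
    one_div, mul_comm h, mul_comm h]

/-- The sign of `1/(-h)` and the reversed orientation of the integral cancel. Mirror images thus
become meshes of negative cell size, and every later estimate is stated in `|h|` to cover both
biases. -/
theorem cellAverage_reflect (u : ℝ → ℝ) (x h : ℝ) (k i : ℤ) :
    cellAverage u x h (k - i) = cellAverage u (x + k * h) (-h) i := by
  rw [cellAverage, cellAverage, intervalIntegral.integral_symm, one_div_neg_eq_neg_one_div,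
    mul_neg, neg_mul]
  push_cast
  congr 3 <;> ring

theorem cellAverage_shift (u : ℝ → ℝ) (x h : ℝ) (k i : ℤ) :
    cellAverage u x h (k + i) = cellAverage u (x + k * h) h i := by
  rw [cellAverage, cellAverage]
  push_cast
  congr 2 <;> ring

/-- The derivatives of the substencil polynomials depend continuously on the function. -/
theorem exists_bound_subPoly_sub (r : ℕ) :
    ∃ K : ℝ, 0 ≤ K ∧ ∀ (w z : ℝ → ℝ) (η : ℝ), Continuous w → Continuous z →
      (∀ ξ ∈ Set.Icc (-(r : ℝ)) r, |w ξ - z ξ| ≤ η) → ∀ s < r, ∀ l < r,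
      ∀ ξ ∈ Set.Icc (-(1 / 2) : ℝ) (1 / 2),
        |(derivative^[l] (subPoly r s (unitAverage w))).eval ξ -
          (derivative^[l] (subPoly r s (unitAverage z))).eval ξ| ≤ K * η := by
  choose K hK0 hK using fun s l : ℕ =>
    exists_bound_iterate_derivative_reconPoly ((s : ℤ) - (r : ℤ) + 1) r l
  refine ⟨∑ s ∈ Finset.range r, ∑ l ∈ Finset.range r, K s l,
    Finset.sum_nonneg fun s _ => Finset.sum_nonneg fun l _ => hK0 s l, ?_⟩
  intro w z η hw hz hη s hs l hl ξ hξ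
  have hη0 : 0 ≤ η := (abs_nonneg _).trans
    (hη 0 ⟨neg_nonpos.2 r.cast_nonneg, r.cast_nonneg⟩)
  have hle : K s l ≤ ∑ s ∈ Finset.range r, ∑ l ∈ Finset.range r, K s l :=
    (Finset.single_le_sum (f := fun l => K s l) (fun l _ => hK0 s l) (Finset.mem_range.2 hl)).trans
      (Finset.single_le_sum (f := fun s => ∑ l ∈ Finset.range r, K s l)
        (fun s _ => Finset.sum_nonneg fun l _ => hK0 s l) (Finset.mem_range.2 hs))
  rw [← eval_sub, ← iterate_derivative_sub, subPoly, subPoly, ← reconPoly_sub]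
  refine (hK s l _ η (fun j hj => ?_) ξ hξ).trans (mul_le_mul_of_nonneg_right hle hη0)
  rw [← unitAverage_sub hw hz]
  refine abs_unitAverage_le fun y hy => hη y ?_
  have hsr : (s : ℝ) + 1 ≤ r := by exact_mod_cast hs
  have hjr : (j : ℝ) + 1 ≤ r := by exact_mod_cast hj
  have hs0 : (0 : ℝ) ≤ s := s.cast_nonneg
  have hj0 : (0 : ℝ) ≤ j := j.cast_nonneg
  push_cast at hy
  exact ⟨by linarith [hy.1], by linarith [hy.2]⟩

/-! ### Error of the linear reconstruction -/

/-- The error at `1/2` of the reconstruction with the ideal weights. -/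
noncomputable def linError (r : ℕ) (w : ℝ → ℝ) : ℝ :=
  ∑ s ∈ Finset.range r, idealWeight r s * subRecon r s (unitAverage w) - w (1 / 2)

theorem linError_sub (r : ℕ) {w z : ℝ → ℝ} (hw : Continuous w) (hz : Continuous z) :
    linError r (fun ξ => w ξ - z ξ) = linError r w - linError r z := by
  have : unitAverage (fun ξ => w ξ - z ξ) = fun i => unitAverage w i - unitAverage z i :=
    funext fun i => unitAverage_sub hw hz i
  simp only [linError, this, subRecon, subPoly, reconPoly_sub, eval_sub, mul_sub,
    Finset.sum_sub_distrib]
  ring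

/-- Subtracting a Taylor polynomial of degree `2r - 2`, on which the ideal weights are exact, leaves
only its remainder on `[-r, r]`. -/
theorem exists_bound_linError (r : ℕ) (hr : 1 ≤ r) :
    ∃ K : ℝ, 0 ≤ K ∧ ∀ (w : ℝ → ℝ) (M : ℝ), ContDiff ℝ (2 * r - 1 : ℕ) w →
      (∀ ξ ∈ Set.Icc (-(r : ℝ)) r, |iteratedDeriv (2 * r - 1) w ξ| ≤ M) →
      |linError r w| ≤ K * M := by
  obtain ⟨K, hK0, hK⟩ := exists_bound_subPoly_sub r
  have hd0 : ∀ s, 0 ≤ idealWeight r s := fun s => by unfold idealWeight; positivity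
  -- `K` accounts for the substencil values, `1` for the point value, and the power of `2r` for the
  -- Taylor remainder.
  refine ⟨(K + 1) * ((r : ℝ) - -(r : ℝ)) ^ (2 * r - 1), by
    have : (0 : ℝ) ≤ (r : ℝ) - -(r : ℝ) := by rw [sub_neg_eq_add]; positivity
    positivity, fun w M hw hM => ?_⟩
  have hr0 : (1 : ℝ) ≤ r := by exact_mod_cast hr
  set T := taylorPoly w (2 * r - 2) (-(r : ℝ)) with hT
  set η := ((r : ℝ) - -(r : ℝ)) ^ (2 * r - 1) * M with hη
  have hN : 2 * r - 2 + 1 = 2 * r - 1 := by omega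
  have hRem : ∀ ξ ∈ Set.Icc (-(r : ℝ)) r, |w ξ - T.eval ξ| ≤ η := by
    intro ξ hξ
    have := abs_sub_taylorPoly_le (w := w) (k := 2 * r - 2) (a := -(r : ℝ)) (b := r) (M := M)
      (by linarith) (by rwa [hN]) (by rwa [hN]) hξ
    rwa [hN] at this
  have hex := sum_idealWeight_mul_subRecon r hr T (by rw [← hN]; exact degree_taylorPoly_lt _ _ _)
  have e : linError r w = ∑ s ∈ Finset.range r, idealWeight r s *
      (subRecon r s (unitAverage w) - subRecon r s (unitAverage fun ξ => T.eval ξ)) -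
      (w (1 / 2) - T.eval (1 / 2)) := by
    simp only [linError, mul_sub, Finset.sum_sub_distrib, hex]
    ring
  have h1 : |∑ s ∈ Finset.range r, idealWeight r s *
      (subRecon r s (unitAverage w) - subRecon r s (unitAverage fun ξ => T.eval ξ))| ≤ K * η := by
    refine (Finset.abs_sum_le_sum_abs _ _).trans ?_
    calc _ ≤ ∑ s ∈ Finset.range r, idealWeight r s * (K * η) := by
          refine Finset.sum_le_sum fun s hs => ?_
          rw [abs_mul, abs_of_nonneg (hd0 s)]
          exact mul_le_mul_of_nonneg_left (hK w (fun ξ => T.eval ξ) η hw.continuous T.continuous hRem s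
            (Finset.mem_range.1 hs) 0 hr (1 / 2) ⟨by norm_num, le_rfl⟩) (hd0 s)
      _ = K * η := by rw [← Finset.sum_mul, sum_idealWeight r hr, one_mul]
  have h2 := hRem (1 / 2) ⟨by linarith, by linarith⟩
  rw [e]
  calc _ ≤ K * η + η := (abs_sub _ _).trans (add_le_add h1 h2)
    _ = _ := by rw [hη]; ring

theorem iteratedDeriv_comp_affine {u : ℝ → ℝ} {k : ℕ} (hu : ContDiff ℝ k u) (x h ξ : ℝ) :
    iteratedDeriv k (fun ξ => u (x + h * ξ)) ξ = h ^ k * iteratedDeriv k u (x + h * ξ) := by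
  have h1 : ContDiff ℝ k fun y => u (x + y) := hu.comp (contDiff_const.add contDiff_id)
  have := congrFun (iteratedDeriv_comp_const_mul h1 h) ξ
  rw [this, iteratedDeriv_comp_const_add]

theorem contDiff_comp_affine {u : ℝ → ℝ} {k : WithTop ℕ∞} (hu : ContDiff ℝ k u) (x h : ℝ) :
    ContDiff ℝ k fun ξ => u (x + h * ξ) :=
  hu.comp (contDiff_const.add (contDiff_const.mul contDiff_id))

/-- The reconstruction with the ideal weights is accurate of order `2 r - 1`, and its error
varies slowly from cell to cell. -/
theorem exists_bound_linError_affine (r : ℕ) (hr : 1 ≤ r) {u : ℝ → ℝ} {M : ℝ}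
    (hu : ContDiff ℝ (2 * r : ℕ) u) (hM : ∀ k ≤ 2 * r, ∀ y, |iteratedDeriv k u y| ≤ M) :
    ∃ K : ℝ, 0 ≤ K ∧ ∀ x h : ℝ,
      |linError r (fun ξ => u (x + h * ξ))| ≤ K * |h| ^ (2 * r - 1) ∧
      ∀ y : ℝ, |linError r (fun ξ => u (x + h * ξ)) - linError r (fun ξ => u (y + h * ξ))| ≤
        K * |h| ^ (2 * r - 1) * |x - y| := by
  obtain ⟨K, hK0, hK⟩ := exists_bound_linError r hr
  have hM0 : 0 ≤ M := (abs_nonneg _).trans (hM 0 (Nat.zero_le _) 0)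
  have hu' : ContDiff ℝ (2 * r - 1 : ℕ) u := hu.of_le (by exact_mod_cast Nat.sub_le _ _)
  have hlip : ∀ a b, |iteratedDeriv (2 * r - 1) u a - iteratedDeriv (2 * r - 1) u b| ≤
      M * |a - b| := by
    intro a b
    have hd : Differentiable ℝ (iteratedDeriv (2 * r - 1) u) :=
      hu.differentiable_iteratedDeriv _ (by exact_mod_cast (by omega : 2 * r - 1 < 2 * r))
    refine convex_univ.norm_image_sub_le_of_norm_deriv_le (fun y _ => hd y) (fun y _ => ?_)
      (Set.mem_univ b) (Set.mem_univ a)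
    rw [← iteratedDeriv_succ, show 2 * r - 1 + 1 = 2 * r by omega]
    exact hM _ le_rfl y
  refine ⟨K * M, mul_nonneg hK0 hM0, fun x h => ⟨?_, fun y => ?_⟩⟩
  · have := hK (fun ξ => u (x + h * ξ)) (|h| ^ (2 * r - 1) * M) (contDiff_comp_affine hu' x h)
      (fun ξ _ => by
        rw [iteratedDeriv_comp_affine hu', abs_mul, abs_pow]
        exact mul_le_mul_of_nonneg_left (hM _ (Nat.sub_le _ _) _) (by positivity))
    linarith
  · have hcx := contDiff_comp_affine hu' x h
    have hcy := contDiff_comp_affine hu' y h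
    -- By linearity the bound applies to the difference of two translates, whose `(2r-1)`-th
    -- derivative is controlled by `hlip`. This is where the extra derivative of `u` enters.
    rw [← linError_sub r hcx.continuous hcy.continuous]
    have := hK (fun ξ => u (x + h * ξ) - u (y + h * ξ)) (|h| ^ (2 * r - 1) * (M * |x - y|))
      (hcx.sub hcy) (fun ξ _ => by
        have e := iteratedDeriv_sub (x := ξ) hcx.contDiffAt hcy.contDiffAt
        change |iteratedDeriv (2 * r - 1) ((fun ξ => u (x + h * ξ)) - fun ξ => u (y + h * ξ)) ξ| ≤ _
        rw [e, iteratedDeriv_comp_affine hu', iteratedDeriv_comp_affine hu', ← mul_sub, abs_mul,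
          abs_pow]
        refine mul_le_mul_of_nonneg_left ((hlip _ _).trans_eq ?_) (by positivity)
        congr 2; ring)
    linarith

/-! ### Localisation -/

/-- A function that is smooth near a point agrees there with a globally smooth one with bounded
derivatives. -/
theorem ContDiffAt.exists_contDiff_bounded {u : ℝ → ℝ} {x₀ : ℝ} {n : ℕ}
    (hu : ContDiffAt ℝ n u x₀) :
    ∃ v : ℝ → ℝ, ContDiff ℝ n v ∧ v =ᶠ[nhds x₀] u ∧
      ∃ M : ℝ, ∀ k ≤ n, ∀ y, |iteratedDeriv k v y| ≤ M := by
  obtain ⟨s, hs, hus⟩ := hu.contDiffOn le_rfl (by simp)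
  obtain ⟨ρ, hρ, hball⟩ := Metric.mem_nhds_iff.1 hs
  let χ : ContDiffBump x₀ := ⟨ρ / 4, ρ / 2, by positivity, by linarith⟩
  have hsupp : tsupport (fun y => χ y * u y) ⊆ Metric.closedBall x₀ (ρ / 2) :=
    (tsupport_mul_subset_left).trans χ.tsupport_eq.subset
  have hcomp : HasCompactSupport (fun y => χ y * u y) :=
    HasCompactSupport.of_support_subset_isCompact (isCompact_closedBall x₀ (ρ / 2))
      ((subset_tsupport _).trans hsupp)
  have hcd : ContDiff ℝ n (fun y => χ y * u y) := by
    rw [contDiff_iff_contDiffAt]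
    intro y
    by_cases hy : y ∈ tsupport (fun y => χ y * u y)
    · have hyb : y ∈ Metric.ball x₀ ρ :=
        Metric.closedBall_subset_ball (by linarith) (hsupp hy)
      exact χ.contDiff.contDiffAt.mul
        (hus.contDiffAt (Filter.mem_of_superset (Metric.isOpen_ball.mem_nhds hyb) hball))
    · exact (contDiffAt_const (c := (0 : ℝ))).congr_of_eventuallyEq (notMem_tsupport_iff_eventuallyEq.1 hy)
  refine ⟨fun y => χ y * u y, hcd, ?_, ?_⟩
  · filter_upwards [χ.eventuallyEq_one] with y hy
    simp [hy]
  · have hb : ∀ k, ∃ M : ℝ, 0 ≤ M ∧ (k ≤ n → ∀ y, |iteratedDeriv k (fun y => χ y * u y) y| ≤ M) := by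
      intro k
      by_cases hk : k ≤ n
      · have hc : Continuous (iteratedDeriv k fun y => χ y * u y) :=
          hcd.continuous_iteratedDeriv k (by exact_mod_cast hk)
        obtain ⟨M, hM⟩ := (isCompact_closedBall x₀ (ρ / 2)).exists_bound_of_continuousOn
          hc.continuousOn
        refine ⟨max M 0, le_max_right _ _, fun _ y => ?_⟩
        by_cases hy : y ∈ Metric.closedBall x₀ (ρ / 2)
        · exact (hM y hy).trans (le_max_left _ _)
        · have h0 : (fun y => χ y * u y) =ᶠ[nhds y] fun _ => 0 :=
            notMem_tsupport_iff_eventuallyEq.1 fun h => hy (hsupp h)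
          rw [h0.iteratedDeriv_eq k]
          simp
      · exact ⟨0, le_rfl, fun h => absurd h hk⟩
    choose M hM0 hM using hb
    refine ⟨∑ k ∈ Finset.range (n + 1), M k, fun k hk y => (hM k hk y).trans ?_⟩
    exact Finset.single_le_sum (f := M) (fun k _ => hM0 k) (Finset.mem_range.2 (by omega))

/-! Perturbation of the nonlinear weights. -/

/-- Young's inequality applied to the cross term `2(a-b)b`. The free parameter `θ` is the relative
error to be tolerated. -/
theorem abs_sq_sub_sq_le {a b η θ : ℝ} (hθ : 0 < θ) (h : |a - b| ≤ η) :
    |a ^ 2 - b ^ 2| ≤ θ * b ^ 2 + (1 / θ + 1) * η ^ 2 := by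
  have h1 : (a - b) ^ 2 ≤ η ^ 2 := sq_le_sq' (by linarith [neg_abs_le (a - b)]) ((le_abs_self _).trans h)
  have h2 : 0 ≤ (1 / θ) * (η ^ 2 - (a - b) ^ 2) :=
    mul_nonneg (by positivity) (by linarith)
  have h3 : ∀ e : ℝ, 2 * e * b ≤ θ * b ^ 2 + (1 / θ) * e ^ 2 := by
    intro e
    have : 0 ≤ (1 / θ) * (θ * b - e) ^ 2 := by positivity
    have e1 : (1 / θ) * (θ * b - e) ^ 2 = θ * b ^ 2 - 2 * e * b + (1 / θ) * e ^ 2 := by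
      field_simp; ring
    linarith
  rw [abs_le]
  have h4 := h3 (a - b)
  have h5 := h3 (-(a - b))
  have h6 : 0 ≤ (1 / θ) * (a - b) ^ 2 := by positivity
  constructor <;> nlinarith

/-- The Jiang–Shu functional of a polynomial. -/
noncomputable def smoothness (r : ℕ) (p : ℝ[X]) : ℝ :=
  ∑ l ∈ Finset.Icc 1 (r - 1), ∫ ξ in (-(1 / 2) : ℝ)..(1 / 2), ((derivative^[l] p).eval ξ) ^ 2

theorem abs_smoothness_sub_le {r : ℕ} {p T : ℝ[X]} {η θ : ℝ} (hθ : 0 < θ)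
    (h : ∀ l < r, ∀ ξ ∈ Set.Icc (-(1 / 2) : ℝ) (1 / 2),
      |(derivative^[l] p).eval ξ - (derivative^[l] T).eval ξ| ≤ η) :
    |smoothness r p - smoothness r T| ≤ θ * smoothness r T + r * ((1 / θ + 1) * η ^ 2) := by
  have hint : ∀ q : ℝ[X], IntervalIntegrable (fun ξ => q.eval ξ ^ 2) MeasureTheory.volume
      (-(1 / 2)) (1 / 2) := fun q => (q.continuous.pow 2).intervalIntegrable _ _
  have hη : 0 ≤ (1 / θ + 1) * η ^ 2 := by positivity
  unfold smoothness
  rw [← Finset.sum_sub_distrib, Finset.mul_sum]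
  refine (Finset.abs_sum_le_sum_abs _ _).trans ?_
  calc _ ≤ ∑ l ∈ Finset.Icc 1 (r - 1),
        (θ * (∫ ξ in (-(1 / 2) : ℝ)..(1 / 2), ((derivative^[l] T).eval ξ) ^ 2) +
          (1 / θ + 1) * η ^ 2) := by
        refine Finset.sum_le_sum fun l hl => ?_
        rw [Finset.mem_Icc] at hl
        rw [← intervalIntegral.integral_sub (hint _) (hint _)]
        have := intervalIntegral.norm_integral_le_of_norm_le (μ := MeasureTheory.volume)
          (a := (-(1 / 2) : ℝ)) (b := 1 / 2)
          (f := fun ξ => ((derivative^[l] p).eval ξ) ^ 2 - ((derivative^[l] T).eval ξ) ^ 2)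
          (g := fun ξ => θ * ((derivative^[l] T).eval ξ) ^ 2 + (1 / θ + 1) * η ^ 2)
          (by norm_num) (Filter.Eventually.of_forall fun ξ hξ =>
            abs_sq_sub_sq_le hθ (h l (by omega) ξ ⟨hξ.1.le, hξ.2⟩))
          (((hint _).const_mul θ).add intervalIntegrable_const)
        rw [Real.norm_eq_abs, intervalIntegral.integral_add ((hint _).const_mul θ)
          intervalIntegrable_const, intervalIntegral.integral_const_mul,
          intervalIntegral.integral_const, smul_eq_mul] at this
        refine this.trans_eq ?_
        ring
    _ ≤ _ := by
        rw [Finset.sum_add_distrib, Finset.sum_const, nsmul_eq_mul]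
        refine add_le_add le_rfl (mul_le_mul_of_nonneg_right ?_ hη)
        rw [Nat.card_Icc]
        exact_mod_cast (by omega : r - 1 + 1 - 1 ≤ r)

theorem sq_le_smoothness {r j : ℕ} (hj1 : 1 ≤ j) (hj : j < r) {T : ℝ[X]} {c : ℝ} (hc : 0 ≤ c)
    (h : ∀ ξ ∈ Set.Icc (-(1 / 2) : ℝ) (1 / 2), c ≤ |(derivative^[j] T).eval ξ|) :
    c ^ 2 ≤ smoothness r T := by
  have h1 : c ^ 2 ≤ ∫ ξ in (-(1 / 2) : ℝ)..(1 / 2), ((derivative^[j] T).eval ξ) ^ 2 := by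
    have := intervalIntegral.integral_mono_on (μ := MeasureTheory.volume) (a := (-(1 / 2) : ℝ))
      (b := 1 / 2) (f := fun _ => c ^ 2) (g := fun ξ => ((derivative^[j] T).eval ξ) ^ 2)
      (by norm_num) intervalIntegrable_const
      ((((derivative^[j] T).continuous).pow 2).intervalIntegrable _ _)
      (fun ξ hξ => by rw [← sq_abs ((derivative^[j] T).eval ξ)]; exact pow_le_pow_left₀ hc (h ξ hξ) 2)
    rw [intervalIntegral.integral_const, smul_eq_mul] at this
    linarith
  refine h1.trans (Finset.single_le_sum (f := fun l => ∫ ξ in (-(1 / 2) : ℝ)..(1 / 2),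
    ((derivative^[l] T).eval ξ) ^ 2) (fun l _ => ?_) (Finset.mem_Icc.2 ⟨hj1, by omega⟩))
  exact intervalIntegral.integral_nonneg (by norm_num) fun ξ _ => sq_nonneg _

/-- Normalizing approximations of weights of sum one. -/
theorem abs_div_sum_sub_le {r : ℕ} {y d : ℕ → ℝ} {η : ℝ} (hd0 : ∀ s < r, 0 ≤ d s)
    (hd : ∑ s ∈ Finset.range r, d s = 1) (hy : ∀ s < r, |y s - d s| ≤ η)
    (hη : (r : ℝ) * η ≤ 1 / 2) :
    1 / 2 ≤ ∑ l ∈ Finset.range r, y l ∧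
      ∀ s < r, |y s / ∑ l ∈ Finset.range r, y l - d s| ≤ 2 * (1 + r) * η := by
  have hS : |∑ l ∈ Finset.range r, y l - 1| ≤ r * η := by
    rw [← hd, ← Finset.sum_sub_distrib]
    refine (Finset.abs_sum_le_sum_abs _ _).trans ?_
    refine (Finset.sum_le_sum (g := fun _ => η) fun s hs => hy s (Finset.mem_range.1 hs)).trans ?_
    simp
  set S := ∑ l ∈ Finset.range r, y l with hSdef
  have hS2 : 1 / 2 ≤ S := by linarith [(abs_le.1 hS).1]
  refine ⟨hS2, fun s hs => ?_⟩
  have hSpos : 0 < S := by linarith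
  have hd1 : d s ≤ 1 := hd ▸ Finset.single_le_sum (f := d)
    (fun l hl => hd0 l (Finset.mem_range.1 hl)) (Finset.mem_range.2 hs)
  have hrη : 0 ≤ (r : ℝ) * η := (abs_nonneg _).trans hS
  have e : y s / S - d s = ((y s - d s) - d s * (S - 1)) / S := by field_simp; ring
  rw [e, abs_div, abs_of_pos hSpos, div_le_iff₀ hSpos]
  have h1 : |d s * (S - 1)| ≤ r * η := by
    rw [abs_mul, abs_of_nonneg (hd0 s hs)]
    nlinarith [abs_nonneg (S - 1)]
  have hη0 : 0 ≤ η := (abs_nonneg _).trans (hy s hs)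
  calc _ ≤ η + r * η := (abs_sub _ _).trans (add_le_add (hy s hs) h1)
    _ ≤ _ := by nlinarith

/-- If all smoothness indicators are relatively close to each other, the Jiang–Shu weights are
close to the ideal ones. -/
theorem abs_omegaJS_sub_le {r : ℕ} (hr : 2 ≤ r) {ε κ B : ℝ} {v : ℤ → ℝ} (hε : 0 ≤ ε) (hB : 0 < B)
    (hκ : (r : ℝ) * (10 * κ) ≤ 1 / 2)
    (h : ∀ s < r, |smoothnessIndicator r s v - B| ≤ κ * B) :
    ∀ s < r, |omegaJS r ε v s - idealWeight r s| ≤ 2 * (1 + r) * (10 * κ) := by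
  have hd0 : ∀ s < r, 0 ≤ idealWeight r s := fun s hs => (idealWeight_mem_Ioo hr hs).1.le
  have hr2 : (2 : ℝ) ≤ r := by exact_mod_cast hr
  have hκ0 : 0 ≤ κ := by
    have := (abs_nonneg _).trans (h 0 (by omega))
    by_contra hneg
    nlinarith
  have hκ1 : κ ≤ 1 / 2 := by nlinarith
  -- Normalised weights do not change when all `alphaJS` are multiplied by `A ^ 2`, and the
  -- multiplied ones are close to the ideal weights.
  set A := ε + B with hA
  have hApos : 0 < A := by linarith
  have hy : ∀ s < r, |A ^ 2 * alphaJS r ε v s - idealWeight r s| ≤ 10 * κ := by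
    intro s hs
    have hβ := h s hs
    obtain ⟨hd, hd1⟩ := idealWeight_mem_Ioo hr hs
    unfold alphaJS
    set D := ε + smoothnessIndicator r s v with hD
    have hDA : |D - A| ≤ κ * A := by
      rw [hD, hA, add_sub_add_left_eq_sub]
      refine hβ.trans (mul_le_mul_of_nonneg_left (by linarith) hκ0)
    have hD1 : A / 2 ≤ D := by nlinarith [(abs_le.1 hDA).1]
    have hD2 : D ≤ 3 / 2 * A := by nlinarith [(abs_le.1 hDA).2]
    have hDpos : 0 < D := by linarith
    have e : A ^ 2 * (idealWeight r s / D ^ 2) - idealWeight r s =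
        idealWeight r s * ((A - D) * (A + D)) / D ^ 2 := by field_simp; ring
    rw [e, abs_div, abs_of_pos (by positivity : 0 < D ^ 2), div_le_iff₀ (by positivity), abs_mul,
      abs_mul, abs_of_pos hd, abs_of_pos (by positivity : 0 < A + D), abs_sub_comm]
    -- Since `A ≤ 2D`, one has `A(A + D) ≤ 6D²`; the constant `10` is a generous upper bound.
    calc _ ≤ 1 * (κ * A * (A + D)) := by
          refine mul_le_mul hd1.le (mul_le_mul_of_nonneg_right hDA (by positivity)) (by positivity)
            zero_le_one
      _ ≤ κ * (10 * D ^ 2) := by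
          rw [one_mul, mul_assoc]
          refine mul_le_mul_of_nonneg_left ?_ hκ0
          nlinarith
      _ = _ := by ring
  have key := (abs_div_sum_sub_le hd0 (sum_idealWeight r (by omega)) hy hκ).2
  intro s hs
  have := key s hs
  rwa [← Finset.mul_sum, mul_div_mul_left _ _ (by positivity)] at this

/-! ### Flatness of the order-preserving mapping at the ideal weights -/

theorem continuous_rmDenom (m n : ℕ) (d : ℝ) : Continuous (rmDenom m n d) := by
  unfold rmDenom
  fun_prop

/-- By continuity the denominator keeps at least half its modulus at `d`, while the numerator is
exactly `(ω - d)^(n+1)`. -/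
theorem exists_bound_rmMap_sub {m n : ℕ} {d : ℝ} (hd : rmDenom m n d d ≠ 0) :
    ∃ C τ : ℝ, 0 ≤ C ∧ 0 < τ ∧ ∀ ω, |ω - d| ≤ τ → |rmMap m n d ω - d| ≤ C * |ω - d| ^ (n + 1) := by
  have hc : ContinuousAt (fun ω => |rmDenom m n d ω|) d := (continuous_rmDenom m n d).abs.continuousAt
  have hpos : 0 < |rmDenom m n d d| := abs_pos.2 hd
  obtain ⟨τ, hτ, hb⟩ := Metric.eventually_nhds_iff.1
    (hc.eventually (lt_mem_nhds (half_lt_self hpos)))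
  refine ⟨2 / |rmDenom m n d d|, τ / 2, by positivity, by positivity, fun ω hω => ?_⟩
  have h1 : |rmDenom m n d d| / 2 < |rmDenom m n d ω| :=
    hb (by rw [Real.dist_eq]; linarith)
  rw [rmMap, add_sub_cancel_left, abs_div, abs_pow, div_le_iff₀ (by linarith)]
  have h2 : 1 ≤ 2 / |rmDenom m n d d| * |rmDenom m n d ω| := by
    rw [div_mul_eq_mul_div, le_div_iff₀ hpos]; linarith
  nlinarith [pow_nonneg (abs_nonneg (ω - d)) (n + 1)]

theorem minDistIndex_spec {r : ℕ} (hr : 0 < r) (d : ℕ → ℝ) (ω : ℝ) :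
    minDistIndex r d ω < r ∧ ∀ i < r, |ω - d (minDistIndex r d ω)| ≤ |ω - d i| := by
  have hne : {k : ℕ | k < r ∧ ∀ i < r, |ω - d k| ≤ |ω - d i|}.Nonempty := by
    obtain ⟨k, hk, hmin⟩ := Finset.exists_min_image (Finset.range r) (fun k => |ω - d k|)
      ⟨0, Finset.mem_range.2 hr⟩
    exact ⟨k, Finset.mem_range.1 hk, fun i hi => hmin i (Finset.mem_range.2 hi)⟩
  exact Nat.sInf_mem hne

/-- Near a value `d s` the selected value is `d s` itself. -/
theorem exists_minDist_eq (r : ℕ) (d : ℕ → ℝ) :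
    ∃ τ : ℝ, 0 < τ ∧ ∀ s < r, ∀ ω, |ω - d s| ≤ τ → minDist r d d ω = d s := by
  -- Only distinct values are separated. Coinciding weights may make the selected index differ from
  -- `s`, but the selected value is still `d s`.
  have hgap : ∃ τ : ℝ, 0 < τ ∧ ∀ p ∈ Finset.range r ×ˢ Finset.range r, d p.1 ≠ d p.2 →
      2 * τ < |d p.1 - d p.2| := by
    induction Finset.range r ×ˢ Finset.range r using Finset.induction_on with
    | empty => exact ⟨1, one_pos, by simp⟩
    | insert p S _ ih =>
      obtain ⟨τ, hτ, h⟩ := ih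
      by_cases hp : d p.1 = d p.2
      · refine ⟨τ, hτ, fun q hq hne => ?_⟩
        rcases Finset.mem_insert.1 hq with rfl | hq
        · exact absurd hp hne
        · exact h q hq hne
      · have hp' : 0 < |d p.1 - d p.2| := abs_pos.2 (sub_ne_zero.2 hp)
        refine ⟨min τ (|d p.1 - d p.2| / 4), lt_min hτ (by positivity), fun q hq hne => ?_⟩
        rcases Finset.mem_insert.1 hq with rfl | hq
        · linarith [min_le_right τ (|d q.1 - d q.2| / 4)]
        · linarith [min_le_left τ (|d p.1 - d p.2| / 4), h q hq hne]
  obtain ⟨τ, hτ, h⟩ := hgap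
  refine ⟨τ, hτ, fun s hs ω hω => ?_⟩
  obtain ⟨hk, hmin⟩ := minDistIndex_spec (by omega : 0 < r) d ω
  by_contra hne
  have h1 := h (minDistIndex r d ω, s) (Finset.mem_product.2
    ⟨Finset.mem_range.2 hk, Finset.mem_range.2 hs⟩) hne
  have h2 := hmin s hs
  have h3 := abs_sub_le (d (minDistIndex r d ω)) ω (d s)
  rw [abs_sub_comm (d (minDistIndex r d ω)) ω] at h3
  simp only at h1
  linarith

theorem exists_bound_mopMap_sub {r m n : ℕ} (hr : 2 ≤ r) (hwd : RMWellDefined r m n) :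
    ∃ C τ : ℝ, 0 ≤ C ∧ 0 < τ ∧ ∀ s < r, ∀ ω, |ω - idealWeight r s| ≤ τ →
      |mopMap r m n ω - idealWeight r s| ≤ C * |ω - idealWeight r s| ^ (n + 1) := by
  have hloc : ∀ s, ∃ C τ : ℝ, 0 ≤ C ∧ 0 < τ ∧ (s < r → ∀ ω, |ω - idealWeight r s| ≤ τ →
      |rmMap m n (idealWeight r s) ω - idealWeight r s| ≤ C * |ω - idealWeight r s| ^ (n + 1)) := by
    intro s
    by_cases hs : s < r
    · obtain ⟨C, τ, hC, hτ, h⟩ := exists_bound_rmMap_sub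
        (hwd s hs _ (Set.Ioo_subset_Icc_self (idealWeight_mem_Ioo hr hs)))
      exact ⟨C, τ, hC, hτ, fun _ => h⟩
    · exact ⟨0, 1, le_rfl, one_pos, fun h => absurd h hs⟩
  choose C τ hC hτ h using hloc
  obtain ⟨τ₀, hτ₀, hmin⟩ := exists_minDist_eq r (idealWeight r)
  have hne : (Finset.range r).Nonempty := ⟨0, Finset.mem_range.2 (by omega)⟩
  refine ⟨∑ s ∈ Finset.range r, C s, min τ₀ ((Finset.range r).inf' hne τ),
    Finset.sum_nonneg fun s _ => hC s, lt_min hτ₀ ((Finset.lt_inf'_iff _).2 fun s _ => hτ s),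
    fun s hs ω hω => ?_⟩
  rw [mopMap, hmin s hs ω (hω.trans (min_le_left _ _))]
  refine (h s hs ω (hω.trans ((min_le_right _ _).trans
    (Finset.inf'_le _ (Finset.mem_range.2 hs))))).trans ?_
  exact mul_le_mul_of_nonneg_right
    (Finset.single_le_sum (f := C) (fun s _ => hC s) (Finset.mem_range.2 hs)) (by positivity)

/-! ### Smoothness indicators near a critical point -/

theorem iteratedDeriv_iteratedDeriv (i j : ℕ) (w : ℝ → ℝ) :
    iteratedDeriv i (iteratedDeriv j w) = iteratedDeriv (i + j) w := by
  simp only [iteratedDeriv_eq_iterate, Function.iterate_add_apply]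

theorem exists_pos_forall_mul_abs_le (D : ℝ) {c : ℝ} (hc : 0 < c) :
    ∃ h₀ : ℝ, 0 < h₀ ∧ ∀ h : ℝ, |h| < h₀ → D * |h| ≤ c := by
  refine ⟨c / (|D| + 1), by positivity, fun h hh => ?_⟩
  rw [lt_div_iff₀ (by positivity)] at hh
  nlinarith [le_abs_self D, abs_nonneg h, mul_le_mul_of_nonneg_right (le_abs_self D) (abs_nonneg h)]

/-- On the reference cell the substencil polynomials are close to the Taylor polynomial. -/
theorem exists_bound_subPoly_sub_taylorPoly (r : ℕ) (hr : 1 ≤ r) {u : ℝ → ℝ} {M : ℝ}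
    (hu : ContDiff ℝ r u) (hM : ∀ y, |iteratedDeriv r u y| ≤ M) :
    ∃ K : ℝ, 0 ≤ K ∧ ∀ x h : ℝ,
      (∀ ξ ∈ Set.Icc (-(r : ℝ)) r, |u (x + h * ξ) -
        (taylorPoly (fun ξ => u (x + h * ξ)) (r - 1) (-(r : ℝ))).eval ξ| ≤ K * |h| ^ r) ∧
      ∀ s < r, ∀ l < r, ∀ ξ ∈ Set.Icc (-(1 / 2) : ℝ) (1 / 2),
        |(derivative^[l] (subPoly r s (unitAverage fun ξ => u (x + h * ξ)))).eval ξ -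
          (derivative^[l] (taylorPoly (fun ξ => u (x + h * ξ)) (r - 1) (-(r : ℝ)))).eval ξ| ≤
          K * |h| ^ r := by
  obtain ⟨K, hK0, hK⟩ := exists_bound_subPoly_sub r
  have hM0 : 0 ≤ M := (abs_nonneg _).trans (hM 0)
  have hr1 : (1 : ℝ) ≤ r := by exact_mod_cast hr
  set D := ((r : ℝ) - -(r : ℝ)) ^ r * M with hD
  have hD0 : 0 ≤ D := by
    have : (0 : ℝ) ≤ (r : ℝ) - -(r : ℝ) := by linarith
    positivity
  have hNr : r - 1 + 1 = r := by omega
  have hT : ∀ x h : ℝ, ∀ ξ ∈ Set.Icc (-(r : ℝ)) r, |u (x + h * ξ) -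
        (taylorPoly (fun ξ => u (x + h * ξ)) (r - 1) (-(r : ℝ))).eval ξ| ≤ D * |h| ^ r := by
    intro x h ξ hξ
    have := abs_sub_taylorPoly_le (w := fun ξ => u (x + h * ξ)) (k := r - 1) (a := -(r : ℝ))
      (b := r) (M := |h| ^ r * M) (by linarith) (by rw [hNr]; exact contDiff_comp_affine hu x h)
      (by
        rw [hNr]
        intro y _
        rw [iteratedDeriv_comp_affine hu, abs_mul, abs_pow]
        exact mul_le_mul_of_nonneg_left (hM _) (by positivity)) hξ
    rw [hNr] at this
    refine this.trans_eq ?_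
    rw [hD]; ring
  refine ⟨(K + 1) * D, by positivity, fun x h => ⟨fun ξ hξ => (hT x h ξ hξ).trans ?_, ?_⟩⟩
  · have : 0 ≤ K * D * |h| ^ r := by positivity
    linarith
  · intro s hs l hl ξ hξ
    set T := taylorPoly (fun ξ => u (x + h * ξ)) (r - 1) (-(r : ℝ)) with hTdef
    have := hK (fun ξ => u (x + h * ξ)) (fun ξ => T.eval ξ) (D * |h| ^ r)
      (contDiff_comp_affine hu x h).continuous T.continuous (hT x h) s hs l hl ξ hξ
    have hdeg : T.degree < r := by
      have := degree_taylorPoly_lt (fun ξ => u (x + h * ξ)) (r - 1) (-(r : ℝ))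
      rwa [hNr] at this
    rw [show subPoly r s (unitAverage fun ξ => T.eval ξ) = T from
      reconPoly_unitAverage _ r T hdeg] at this
    refine this.trans ?_
    have : 0 ≤ D * |h| ^ r := by positivity
    linarith

/-- A lower bound for a derivative of the Taylor polynomial near a point where the corresponding
derivative of the function does not vanish. -/
theorem exists_le_abs_iterate_derivative_taylorPoly {r j : ℕ} (hj : j < r) {u : ℝ → ℝ} {M x₀ : ℝ}
    (hu : ContDiff ℝ r u) (hM : ∀ k ≤ r, ∀ y, |iteratedDeriv k u y| ≤ M)
    (hne : iteratedDeriv j u x₀ ≠ 0) :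
    ∃ c δ h₀ : ℝ, 0 < c ∧ 0 < δ ∧ 0 < h₀ ∧ ∀ x h : ℝ, |x - x₀| < δ → |h| < h₀ →
      ∀ ξ ∈ Set.Icc (-(1 / 2) : ℝ) (1 / 2), c * |h| ^ j ≤
        |(derivative^[j] (taylorPoly (fun ξ => u (x + h * ξ)) (r - 1) (-(r : ℝ)))).eval ξ| := by
  have hM0 : 0 ≤ M := (abs_nonneg _).trans (hM 0 (Nat.zero_le _) 0)
  have hr1 : (1 : ℝ) ≤ r := by exact_mod_cast (by omega : 1 ≤ r)
  have hcont : Continuous fun y => |iteratedDeriv j u y| :=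
    (hu.continuous_iteratedDeriv j (by exact_mod_cast hj.le)).abs
  have hpos : 0 < |iteratedDeriv j u x₀| := abs_pos.2 hne
  obtain ⟨ρ, hρ, hb⟩ := Metric.eventually_nhds_iff.1
    (hcont.continuousAt.eventually (lt_mem_nhds (half_lt_self hpos)))
  -- One factor `1/2` is lost to continuity in the expansion point, the other to the higher Taylor
  -- terms, which carry an extra factor `|h|`.
  set c := |iteratedDeriv j u x₀| / 4 with hc
  have hc0 : 0 < c := by positivity
  obtain ⟨h₁, hh₁, H₁⟩ := exists_pos_forall_mul_abs_le (r * ((2 * r : ℝ) ^ r * M)) hc0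
  refine ⟨c, ρ / 2, min 1 (min h₁ (ρ / (2 * r))), hc0, by positivity,
    lt_min one_pos (lt_min hh₁ (by positivity)), fun x h hx hh ξ hξ => ?_⟩
  have hh1 : |h| ≤ 1 := (hh.trans_le (min_le_left _ _)).le
  have hh2 := H₁ h (hh.trans_le ((min_le_right _ _).trans (min_le_left _ _)))
  have hh3 : |h| < ρ / (2 * r) := hh.trans_le ((min_le_right _ _).trans (min_le_right _ _))
  rw [lt_div_iff₀ (by positivity)] at hh3
  have hlow : 2 * c < |iteratedDeriv j u (x + h * -(r : ℝ))| := by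
    have : dist (x + h * -(r : ℝ)) x₀ < ρ := by
      rw [Real.dist_eq, show x + h * -(r : ℝ) - x₀ = (x - x₀) - h * r by ring]
      refine (abs_sub _ _).trans_lt ?_
      rw [abs_mul, abs_of_nonneg (by linarith : (0 : ℝ) ≤ r)]
      linarith
    have := hb this
    rw [hc]; linarith
  obtain ⟨k, hk⟩ : ∃ k, r - 1 = k + j := ⟨r - 1 - j, by omega⟩
  rw [hk, iterate_derivative_taylorPoly, eval_taylorPoly, Finset.sum_range_succ']
  simp only [iteratedDeriv_iteratedDeriv, pow_zero, mul_one, Nat.factorial_zero, Nat.cast_one,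
    div_one, zero_add]
  have hder : ∀ i ≤ r, iteratedDeriv i (fun ξ => u (x + h * ξ)) (-(r : ℝ)) =
      h ^ i * iteratedDeriv i u (x + h * -(r : ℝ)) := fun i hi =>
    iteratedDeriv_comp_affine (hu.of_le (by exact_mod_cast hi)) x h _
  rw [hder j hj.le]
  set R := ∑ i ∈ Finset.range k, iteratedDeriv (i + 1 + j) (fun ξ => u (x + h * ξ)) (-(r : ℝ)) /
    ((i + 1).factorial : ℝ) * (ξ - -(r : ℝ)) ^ (i + 1) with hR
  have hRb : |R| ≤ r * ((2 * r : ℝ) ^ r * M * |h|) * |h| ^ j := by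
    refine (Finset.abs_sum_le_sum_abs _ _).trans ?_
    refine (Finset.sum_le_sum (g := fun _ => (2 * r : ℝ) ^ r * M * |h| * |h| ^ j)
      fun i hi => ?_).trans ?_
    · rw [Finset.mem_range] at hi
      have hf : (1 : ℝ) ≤ ((i + 1).factorial : ℝ) := by exact_mod_cast (i + 1).factorial_pos
      rw [hder _ (by omega), abs_mul, abs_div, abs_mul, abs_pow, abs_pow,
        abs_of_pos (by linarith : (0 : ℝ) < ((i + 1).factorial : ℝ))]
      have hx0 : 0 ≤ ξ - -(r : ℝ) := by linarith [hξ.1]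
      have hx1 : ξ - -(r : ℝ) ≤ 2 * r := by linarith [hξ.2]
      have e1 : |ξ - -(r : ℝ)| ^ (i + 1) ≤ (2 * r : ℝ) ^ r := by
        rw [abs_of_nonneg hx0]
        exact (pow_le_pow_left₀ hx0 hx1 _).trans
          (pow_le_pow_right₀ (by linarith) (by omega))
      have e2 : |h| ^ (i + 1 + j) ≤ |h| * |h| ^ j := by
        rw [← pow_succ']
        exact pow_le_pow_of_le_one (abs_nonneg _) hh1 (by omega)
      have e3 : |h| ^ (i + 1 + j) * |iteratedDeriv (i + 1 + j) u (x + h * -(r : ℝ))| /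
          ((i + 1).factorial : ℝ) ≤ |h| * |h| ^ j * M := by
        refine (div_le_self (by positivity) hf).trans ?_
        exact mul_le_mul e2 (hM _ (by omega) _) (abs_nonneg _) (by positivity)
      calc _ ≤ |h| * |h| ^ j * M * (2 * r : ℝ) ^ r :=
            mul_le_mul e3 e1 (by positivity) (by positivity)
        _ = _ := by ring
    · rw [Finset.sum_const, Finset.card_range, nsmul_eq_mul]
      have hkr : (k : ℝ) ≤ r := by exact_mod_cast (by omega : k ≤ r)
      have : 0 ≤ (2 * r : ℝ) ^ r * M * |h| * |h| ^ j := by positivity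
      nlinarith
  have hRb2 : |R| ≤ c * |h| ^ j :=
    hRb.trans (mul_le_mul_of_nonneg_right (by linarith) (by positivity))
  have hmain : 2 * c * |h| ^ j ≤ |h ^ j * iteratedDeriv j u (x + h * -(r : ℝ))| := by
    rw [abs_mul, abs_pow, mul_comm]
    exact mul_le_mul_of_nonneg_left hlow.le (by positivity)
  have htri := abs_sub_abs_le_abs_sub (h ^ j * iteratedDeriv j u (x + h * -(r : ℝ))) (-R)
  rw [abs_neg, sub_neg_eq_add, add_comm _ R] at htri
  linarith

/-- Where some derivative of order `j < r` does not vanish, all smoothness indicators agree up to a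
relative error of order `r - j`. -/
theorem exists_bound_smoothnessIndicator_sub {r j : ℕ} (hj1 : 1 ≤ j) (hj : j < r) {u : ℝ → ℝ}
    {M x₀ : ℝ} (hu : ContDiff ℝ r u) (hM : ∀ k ≤ r, ∀ y, |iteratedDeriv k u y| ≤ M)
    (hne : iteratedDeriv j u x₀ ≠ 0) :
    ∃ K δ h₀ : ℝ, 0 ≤ K ∧ 0 < δ ∧ 0 < h₀ ∧ ∀ x h : ℝ, |x - x₀| < δ → h ≠ 0 → |h| < h₀ →
      ∃ B : ℝ, 0 < B ∧ ∀ s < r,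
        |smoothnessIndicator r s (unitAverage fun ξ => u (x + h * ξ)) - B| ≤
          K * |h| ^ (r - j) * B := by
  obtain ⟨K, hK0, hK⟩ := exists_bound_subPoly_sub_taylorPoly r (by omega) hu (hM r le_rfl)
  obtain ⟨c, δ, h₀, hc, hδ, hh₀, hlow⟩ :=
    exists_le_abs_iterate_derivative_taylorPoly hj hu hM hne
  refine ⟨1 + 2 * r * K ^ 2 / c ^ 2, δ, min 1 h₀, by positivity, hδ, lt_min one_pos hh₀,
    fun x h hx hh0 hh => ?_⟩
  have hpos : 0 < |h| := abs_pos.2 hh0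
  have hh1 : |h| ≤ 1 := (hh.trans_le (min_le_left _ _)).le
  set T := taylorPoly (fun ξ => u (x + h * ξ)) (r - 1) (-(r : ℝ)) with hT
  have hB : (c * |h| ^ j) ^ 2 ≤ smoothness r T := sq_le_smoothness hj1 hj (by positivity)
    (hlow x h hx (hh.trans_le (min_le_right _ _)))
  refine ⟨smoothness r T, lt_of_lt_of_le (by positivity) hB, fun s hs => ?_⟩
  -- This choice balances Young's inequality: with `η` of order `|h|^r`, the term `η²/θ` is of order
  -- `θ |h|^(2j)`, hence at most a constant times `θ B`, like the other term.
  set θ := |h| ^ (r - j) with hθ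
  have hθ0 : 0 < θ := by positivity
  have hθ1 : θ ≤ 1 := pow_le_one₀ hpos.le hh1
  have key : |smoothness r (subPoly r s (unitAverage fun ξ => u (x + h * ξ))) - smoothness r T| ≤ _ :=
    abs_smoothness_sub_le (η := K * |h| ^ r) hθ0 ((hK x h).2 s hs)
  refine key.trans ?_
  have e1 : |h| ^ r = θ * |h| ^ j := by rw [hθ, ← pow_add]; congr 1; omega
  have e2 : (1 / θ + 1) * (K * |h| ^ r) ^ 2 ≤ 2 * K ^ 2 * θ * (|h| ^ j) ^ 2 := by
    have : (1 / θ + 1) * (K * |h| ^ r) ^ 2 = (1 + θ) * (K ^ 2 * θ * (|h| ^ j) ^ 2) := by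
      rw [e1]; field_simp
    rw [this]
    have : 0 ≤ K ^ 2 * θ * (|h| ^ j) ^ 2 := by positivity
    nlinarith
  have e3 : 2 * K ^ 2 * θ * (|h| ^ j) ^ 2 ≤ 2 * K ^ 2 / c ^ 2 * θ * smoothness r T := by
    calc _ = 2 * K ^ 2 / c ^ 2 * θ * (c * |h| ^ j) ^ 2 := by field_simp
      _ ≤ _ := mul_le_mul_of_nonneg_left hB (by positivity)
  calc _ ≤ θ * smoothness r T + r * (2 * K ^ 2 / c ^ 2 * θ * smoothness r T) := by
        exact add_le_add le_rfl (mul_le_mul_of_nonneg_left (e2.trans e3) r.cast_nonneg)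
    _ = _ := by ring

/-! ### Expansion of the nonlinear reconstruction -/

/-- The nonlinear reconstruction agrees with the reconstruction with the ideal weights up to order
`2 r`. -/
theorem exists_bound_mopRecon_sub {r m n j : ℕ} (hj1 : 1 ≤ j) (hj : j < r)
    (hwd : RMWellDefined r m n) (hn : r ≤ (r - j) * (n + 1)) {u : ℝ → ℝ}
    {M x₀ : ℝ} (hu : ContDiff ℝ r u) (hM : ∀ k ≤ r, ∀ y, |iteratedDeriv k u y| ≤ M)
    (hne : iteratedDeriv j u x₀ ≠ 0) :
    ∃ K δ h₀ : ℝ, 0 ≤ K ∧ 0 < δ ∧ 0 < h₀ ∧ ∀ ε x h : ℝ, 0 ≤ ε → |x - x₀| < δ → h ≠ 0 → |h| < h₀ →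
      |mopRecon r m n ε (unitAverage fun ξ => u (x + h * ξ)) - u (x + h / 2) -
        linError r (fun ξ => u (x + h * ξ))| ≤ K * |h| ^ (2 * r) := by
  obtain ⟨K₁, hK₁0, hK₁⟩ := exists_bound_subPoly_sub_taylorPoly r (by omega) hu (hM r le_rfl)
  obtain ⟨K₂, δ, h₁, hK₂0, hδ, hh₁, hβ⟩ := exists_bound_smoothnessIndicator_sub hj1 hj hu hM hne
  obtain ⟨C, τ, hC, hτ, hmap⟩ := exists_bound_mopMap_sub (by omega : 2 ≤ r) hwd
  set K₃ : ℝ := 2 * (1 + r) * (10 * K₂) with hK₃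
  have hK₃0 : 0 ≤ K₃ := by positivity
  -- The three thresholds make, in turn, the Jiang–Shu normalisation safe, the Jiang–Shu weights
  -- fall in the flat zone of the map, and the sum of mapped weights at least `1/2`.
  obtain ⟨h₂, hh₂, H₂⟩ := exists_pos_forall_mul_abs_le (r * (10 * K₂)) (by norm_num : (0 : ℝ) < 1 / 2)
  obtain ⟨h₃, hh₃, H₃⟩ := exists_pos_forall_mul_abs_le K₃ hτ
  obtain ⟨h₄, hh₄, H₄⟩ := exists_pos_forall_mul_abs_le (r * (C * K₃ ^ (n + 1)))
    (by norm_num : (0 : ℝ) < 1 / 2)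
  refine ⟨r * (2 * (1 + r) * (C * K₃ ^ (n + 1)) * (2 * K₁)), δ, min (min 1 h₁) (min h₂ (min h₃ h₄)),
    by positivity, hδ, lt_min (lt_min one_pos hh₁) (lt_min hh₂ (lt_min hh₃ hh₄)),
    fun ε x h hε hx hh0 hh => ?_⟩
  simp only [lt_min_iff] at hh
  obtain ⟨⟨hh1, hhh₁⟩, hhh₂, hhh₃, hhh₄⟩ := hh
  set v := unitAverage fun ξ => u (x + h * ξ) with hv
  have hq : |h| ^ (r - j) ≤ |h| := pow_le_of_le_one (abs_nonneg _) hh1.le (by omega)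
  obtain ⟨B, hB, hβ'⟩ := hβ x h hx hh0 hhh₁
  have hω : ∀ s < r, |omegaJS r ε v s - idealWeight r s| ≤ K₃ * |h| ^ (r - j) := by
    intro s hs
    have := abs_omegaJS_sub_le (by omega : 2 ≤ r) (κ := K₂ * |h| ^ (r - j)) hε hB (by
      refine le_trans ?_ (H₂ h hhh₂)
      calc _ = r * (10 * K₂) * |h| ^ (r - j) := by ring
        _ ≤ _ := mul_le_mul_of_nonneg_left hq (by positivity)) hβ' s hs
    refine this.trans_eq ?_
    rw [hK₃]; ring
  have hα : ∀ s < r, |alphaMOP r m n ε v s - idealWeight r s| ≤ C * K₃ ^ (n + 1) * |h| ^ r := by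
    intro s hs
    refine (hmap s hs _ ((hω s hs).trans
      ((mul_le_mul_of_nonneg_left hq hK₃0).trans (H₃ h hhh₃)))).trans ?_
    rw [mul_assoc]
    refine mul_le_mul_of_nonneg_left ?_ hC
    refine (pow_le_pow_left₀ (abs_nonneg _) (hω s hs) _).trans ?_
    rw [mul_pow, ← pow_mul]
    exact mul_le_mul_of_nonneg_left (pow_le_pow_of_le_one (abs_nonneg _) hh1.le hn) (by positivity)
  have hd0 : ∀ s < r, 0 ≤ idealWeight r s := fun s hs => (idealWeight_mem_Ioo (by omega) hs).1.le
  obtain ⟨hS, hw⟩ := abs_div_sum_sub_le hd0 (sum_idealWeight r (by omega)) hα (by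
    refine le_trans ?_ (H₄ h hhh₄)
    rw [← mul_assoc]
    exact mul_le_mul_of_nonneg_left (pow_le_of_le_one (abs_nonneg _) hh1.le (by omega))
      (by positivity))
  have hsum : ∑ s ∈ Finset.range r, omegaMOP r m n ε v s = 1 := by
    simp only [omegaMOP]
    rw [← Finset.sum_div, div_self (by linarith)]
  have hrec : ∀ s < r, |subRecon r s v - u (x + h / 2)| ≤ 2 * K₁ * |h| ^ r := by
    intro s hs
    have a1 := (hK₁ x h).2 s hs 0 (by omega) (1 / 2) ⟨by norm_num, le_rfl⟩
    have hr1 : (1 : ℝ) ≤ r := by exact_mod_cast (by omega : 1 ≤ r)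
    have a2 := (hK₁ x h).1 (1 / 2) ⟨by linarith, by linarith⟩
    rw [mul_one_div] at a2
    rw [abs_sub_comm] at a2
    have := abs_sub_le (subRecon r s v)
      ((taylorPoly (fun ξ => u (x + h * ξ)) (r - 1) (-(r : ℝ))).eval (1 / 2)) (u (x + h / 2))
    refine this.trans ((add_le_add a1 a2).trans_eq ?_)
    ring
  -- Both families of weights sum to one, so the point value may be subtracted from each substencil
  -- value; this makes the error a product of two small factors.
  have e : mopRecon r m n ε v - u (x + h / 2) - linError r (fun ξ => u (x + h * ξ)) =
      ∑ s ∈ Finset.range r, (omegaMOP r m n ε v s - idealWeight r s) *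
        (subRecon r s v - u (x + h / 2)) := by
    simp only [mul_sub, sub_mul, Finset.sum_sub_distrib, ← Finset.sum_mul, hsum,
      sum_idealWeight r (by omega : 1 ≤ r)]
    rw [mopRecon, linError, mul_one_div]
    ring
  rw [e]
  refine (Finset.abs_sum_le_sum_abs _ _).trans ?_
  calc _ ≤ ∑ s ∈ Finset.range r, (2 * (1 + r) * (C * K₃ ^ (n + 1) * |h| ^ r)) *
        (2 * K₁ * |h| ^ r) := by
        refine Finset.sum_le_sum fun s hs => ?_
        rw [Finset.mem_range] at hs
        rw [abs_mul]
        exact mul_le_mul (hw s hs) (hrec s hs) (abs_nonneg _) (by positivity)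
    _ = _ := by
        rw [Finset.sum_const, Finset.card_range, nsmul_eq_mul, two_mul r, pow_add]
        ring

theorem reconPoly_congr {a : ℤ} {k : ℕ} {v w : ℤ → ℝ} (h : ∀ j < k, v (a + (j : ℤ)) = w (a + (j : ℤ))) :
    reconPoly a k v = reconPoly a k w := by
  unfold reconPoly
  congr 1
  refine Lagrange.interpolate_eq_of_values_eq_on _ _ fun i hi => ?_
  rw [Finset.mem_range] at hi
  refine Finset.sum_congr rfl fun j hj => h j ?_
  rw [Finset.mem_range] at hj
  omega

/-- The reconstruction depends only on the data in the `2 r - 1` cells of the full stencil. -/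
theorem mopRecon_congr {r m n : ℕ} {ε : ℝ} {v w : ℤ → ℝ}
    (h : ∀ i : ℤ, -(r : ℤ) < i → i < r → v i = w i) : mopRecon r m n ε v = mopRecon r m n ε w := by
  have hp : ∀ s ∈ Finset.range r, subPoly r s v = subPoly r s w := fun s hs => by
    rw [Finset.mem_range] at hs
    exact reconPoly_congr fun j hj => h _ (by omega) (by omega)
  have hα : ∀ s ∈ Finset.range r, alphaJS r ε v s = alphaJS r ε w s := fun s hs => by
    simp only [alphaJS, smoothnessIndicator, hp s hs]
  have hω : ∀ s ∈ Finset.range r, alphaMOP r m n ε v s = alphaMOP r m n ε w s := fun s hs => by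
    simp only [alphaMOP, omegaJS, hα s hs, Finset.sum_congr rfl hα]
  refine Finset.sum_congr rfl fun s hs => ?_
  simp only [omegaMOP, subRecon, hω s hs, Finset.sum_congr rfl hω, hp s hs]

/-- The cells of the full stencil lie within `r |h|` of `x`; convexity of the ball covers either
orientation of the integral. -/
theorem cellAverage_congr {u v : ℝ → ℝ} {x₀ ρ : ℝ} (huv : ∀ y, |y - x₀| < ρ → u y = v y)
    {r : ℕ} {x h : ℝ} (hxh : |x - x₀| + r * |h| < ρ) {i : ℤ} (hi : -(r : ℤ) < i) (hi' : i < r) :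
    cellAverage u x h i = cellAverage v x h i := by
  have h1 : (i : ℝ) ≤ r - 1 := by exact_mod_cast (by omega : i ≤ (r : ℤ) - 1)
  have h2 : -((r : ℝ) - 1) ≤ i := by exact_mod_cast (by omega : -((r : ℤ) - 1) ≤ i)
  have hend : ∀ t : ℝ, -(r : ℝ) ≤ t → t ≤ r → x + t * h ∈ Metric.ball x₀ ρ := by
    intro t ht ht'
    rw [Metric.mem_ball, Real.dist_eq, show x + t * h - x₀ = (x - x₀) + t * h by ring]
    refine (abs_add_le _ _).trans_lt (lt_of_le_of_lt ?_ hxh)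
    rw [abs_mul]
    exact add_le_add le_rfl (mul_le_mul_of_nonneg_right (abs_le.2 ⟨ht, ht'⟩) (abs_nonneg _))
  unfold cellAverage
  congr 1
  refine intervalIntegral.integral_congr fun y hy => ?_
  have := (convex_ball x₀ ρ).ordConnected.uIcc_subset (hend ((i : ℝ) - 1 / 2) (by linarith)
    (by linarith)) (hend ((i : ℝ) + 1 / 2) (by linarith) (by linarith)) hy
  rw [Metric.mem_ball, Real.dist_eq] at this
  exact huv y this

/-- Error expansion of the reconstruction near a critical point: a slowly varying error `E` of
order `2 r - 1` and a remainder of order `2 r`. The cell size `h` may be negative, which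
corresponds to the mirror image. -/
theorem exists_mopRecon_expansion {r m n j : ℕ} (hj1 : 1 ≤ j) (hj : j < r)
    (hwd : RMWellDefined r m n) (hn : r ≤ (r - j) * (n + 1)) {u : ℝ → ℝ} {x₀ : ℝ}
    (hu : ContDiffAt ℝ (2 * r : ℕ) u x₀) (hne : iteratedDeriv j u x₀ ≠ 0) :
    ∃ (K δ : ℝ) (E : ℝ → ℝ → ℝ), 0 ≤ K ∧ 0 < δ ∧
      (∀ x h, |E x h| ≤ K * |h| ^ (2 * r - 1)) ∧
      (∀ x y h, |E x h - E y h| ≤ K * |h| ^ (2 * r - 1) * |x - y|) ∧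
      (∀ x y, |x - x₀| < δ → |y - x₀| < δ → |u x - u y| ≤ K * |x - y|) ∧
      ∀ ε x h : ℝ, 0 ≤ ε → |x - x₀| < δ → h ≠ 0 → |h| < δ →
        |mopRecon r m n ε (cellAverage u x h) - u (x + h / 2) - E x h| ≤ K * |h| ^ (2 * r) := by
  obtain ⟨v, hv, hvu, M, hM⟩ := hu.exists_contDiff_bounded
  have hM0 : 0 ≤ M := (abs_nonneg _).trans (hM 0 (Nat.zero_le _) 0)
  obtain ⟨ρ, hρ, hball⟩ := Metric.eventually_nhds_iff.1 hvu
  have hvu' : ∀ y, |y - x₀| < ρ → u y = v y := fun y hy => (hball (by rwa [Real.dist_eq])).symm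
  have hv' : ContDiff ℝ r v := hv.of_le (by exact_mod_cast (by omega : r ≤ 2 * r))
  obtain ⟨K₁, hK₁, hE⟩ := exists_bound_linError_affine r (by omega) hv hM
  obtain ⟨K₂, δ, h₀, hK₂, hδ, hh₀, hrec⟩ := exists_bound_mopRecon_sub hj1 hj hwd hn hv'
    (fun k hk => hM k (by omega)) (x₀ := x₀) (by rwa [hvu.iteratedDeriv_eq j])
  have hr1 : (1 : ℝ) ≤ r := by exact_mod_cast (by omega : 1 ≤ r)
  -- The radius `ρ / (2r)` gives the displacement of the centre and the half-width `r |h|` of the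
  -- stencil half of `ρ` each.
  refine ⟨K₁ + K₂ + M, min (min δ h₀) (ρ / (2 * r)), fun x h => linError r fun ξ => v (x + h * ξ),
    by positivity, lt_min (lt_min hδ hh₀) (by positivity), ?_, ?_, ?_, ?_⟩
  · exact fun x h => ((hE x h).1).trans (mul_le_mul_of_nonneg_right (by linarith) (by positivity))
  · exact fun x y h => ((hE x h).2 y).trans (mul_le_mul_of_nonneg_right
      (mul_le_mul_of_nonneg_right (by linarith) (by positivity)) (abs_nonneg _))
  · intro x y hx hy
    have hle : ρ / (2 * r) ≤ ρ := div_le_self hρ.le (by linarith)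
    rw [hvu' x (hx.trans_le ((min_le_right _ _).trans hle)),
      hvu' y (hy.trans_le ((min_le_right _ _).trans hle))]
    have hlip := convex_univ.norm_image_sub_le_of_norm_deriv_le (f := v) (C := M)
      (fun z _ => hv.differentiable (by simp; omega) z) (fun z _ => by
        have := hM 1 (by omega) z
        rwa [iteratedDeriv_one] at this) (Set.mem_univ y) (Set.mem_univ x)
    exact hlip.trans (mul_le_mul_of_nonneg_right (by linarith) (abs_nonneg _))
  · intro ε x h hε hx hh0 hh
    simp only [lt_min_iff] at hx hh
    have hx3 := hx.2
    have hh3 := hh.2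
    rw [lt_div_iff₀ (by positivity)] at hx3 hh3
    have hxh : |x - x₀| + r * |h| < ρ := by nlinarith [abs_nonneg (x - x₀)]
    have hpt : |x + h / 2 - x₀| < ρ := by
      rw [show x + h / 2 - x₀ = (x - x₀) + h / 2 by ring]
      refine (abs_add_le _ _).trans_lt (lt_of_le_of_lt ?_ hxh)
      rw [abs_div, abs_two]
      nlinarith [abs_nonneg h]
    rw [mopRecon_congr fun i hi hi' => cellAverage_congr hvu' hxh hi hi', hvu' _ hpt,
      cellAverage_eq_unitAverage v x hh0]
    exact (hrec ε x h hε hx.1.1 hh0 hh.1.2).trans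
      (mul_le_mul_of_nonneg_right (by linarith) (by positivity))

/-! ### Flux differences and the main theorem -/

/-- Perturbations of the arguments of a `C²` function act almost equally at neighbouring points. -/
theorem ContDiffAt.exists_bound_sub_sub_sub {f : ℝ → ℝ} {c : ℝ} (hf : ContDiffAt ℝ 2 f c) :
    ∃ L ρ : ℝ, 0 ≤ L ∧ 0 < ρ ∧ ∀ a b e e' : ℝ, |a - c| < ρ → |b - c| < ρ → |e| < ρ → |e'| < ρ →
      |(f (a + e) - f a) - (f (b + e') - f b)| ≤ L * |e - e'| + L * |e'| * |a - b| := by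
  obtain ⟨g, hg, hgf, L, hL⟩ := ContDiffAt.exists_contDiff_bounded (n := 2) hf
  obtain ⟨ρ, hρ, hball⟩ := Metric.eventually_nhds_iff.1 hgf
  have hfg : ∀ y, |y - c| < ρ → f y = g y := fun y hy => (hball (by rwa [Real.dist_eq])).symm
  have hg1 : ∀ y, |deriv g y| ≤ L := fun y => by
    have := hL 1 (by norm_num) y
    rwa [iteratedDeriv_one] at this
  have hgd : Differentiable ℝ g := hg.differentiable (by simp)
  have hg2 : ∀ y, |deriv (deriv g) y| ≤ L := fun y => by
    have := hL 2 le_rfl y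
    rwa [iteratedDeriv_succ, iteratedDeriv_one] at this
  have hgd2 : Differentiable ℝ (deriv g) := by
    have := hg.differentiable_iteratedDeriv 1 (by norm_num)
    rwa [iteratedDeriv_one] at this
  have hlip : ∀ a b, |g a - g b| ≤ L * |a - b| := fun a b =>
    convex_univ.norm_image_sub_le_of_norm_deriv_le (fun z _ => hgd z) (fun z _ => hg1 z)
      (Set.mem_univ b) (Set.mem_univ a)
  have hlip' : ∀ a b, |deriv g a - deriv g b| ≤ L * |a - b| := fun a b =>
    convex_univ.norm_image_sub_le_of_norm_deriv_le (fun z _ => hgd2 z) (fun z _ => hg2 z)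
      (Set.mem_univ b) (Set.mem_univ a)
  have hL0 : 0 ≤ L := (abs_nonneg _).trans (hg1 0)
  refine ⟨L, ρ / 2, hL0, by positivity, fun a b e e' ha hb he he' => ?_⟩
  have hlt : ∀ {y t : ℝ}, |y - c| < ρ / 2 → |t| < ρ / 2 → |y + t - c| < ρ := fun {y t} hy ht => by
    rw [show y + t - c = (y - c) + t by ring]
    linarith [abs_add_le (y - c) t]
  rw [hfg _ (hlt ha he), hfg _ (hlt hb he'), hfg a (by linarith), hfg b (by linarith)]
  have h1 : |g (a + e) - g (a + e')| ≤ L * |e - e'| := by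
    have := hlip (a + e) (a + e')
    rwa [add_sub_add_left_eq_sub] at this
  -- Mean value inequality for `t ↦ g (t + e') - g t`, whose derivative is at most `L |e'|` because
  -- `g'` is Lipschitz.
  have h2 : |(g (a + e') - g a) - (g (b + e') - g b)| ≤ L * |e'| * |a - b| := by
    refine convex_univ.norm_image_sub_le_of_norm_hasDerivWithin_le
      (f := fun t => g (t + e') - g t) (f' := fun t => deriv g (t + e') - deriv g t)
      (fun t _ => ?_) (fun t _ => ?_) (Set.mem_univ b) (Set.mem_univ a)
    · exact (((hgd (t + e')).hasDerivAt.comp_add_const t e').sub (hgd t).hasDerivAt).hasDerivWithinAt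
    · have := hlip' (t + e') t
      rwa [add_sub_cancel_left] at this
  have := abs_add_le (g (a + e) - g (a + e')) ((g (a + e') - g a) - (g (b + e') - g b))
  rw [show g (a + e) - g (a + e') + (g (a + e') - g a - (g (b + e') - g b)) =
    g (a + e) - g a - (g (b + e') - g b) by ring] at this
  linarith

theorem uMinus_cellAverage (r m n : ℕ) (ε : ℝ) (u : ℝ → ℝ) (x h : ℝ) (k : ℤ) :
    uMinus r m n ε (cellAverage u x h) k = mopRecon r m n ε (cellAverage u (x + k * h) h) := by
  unfold uMinus
  congr 1
  exact funext fun i => cellAverage_shift u x h k i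

theorem uPlus_cellAverage (r m n : ℕ) (ε : ℝ) (u : ℝ → ℝ) (x h : ℝ) (k : ℤ) :
    uPlus r m n ε (cellAverage u x h) k =
      mopRecon r m n ε (cellAverage u (x + (k + 1 : ℤ) * h) (-h)) := by
  unfold uPlus
  congr 1
  exact funext fun i => cellAverage_reflect u x h (k + 1) i

theorem mainTheorem7 (r m n ncp : ℕ) (hmn : m ≤ n) (hn : n ≤ 8)
    (hwd : MOPWENO.RMWellDefined r m n)
    (hcp_pos : 1 ≤ ncp) (hcp_lt : ncp + 1 < r)
    (hreq : (1 + (ncp : ℝ)) / ((r : ℝ) - 1 - (ncp : ℝ)) ≤ (n : ℝ))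
    (u f : ℝ → ℝ) (x₀ α : ℝ)
    (hu : ContDiffAt ℝ ((2 * r : ℕ) : WithTop ℕ∞) u x₀)
    (hcrit : MOPWENO.IsCriticalPointOfOrder u x₀ ncp)
    (hf : ContDiffAt ℝ 2 f (u x₀)) :
    ∃ C δ h₀ : ℝ, 0 < δ ∧ 0 < h₀ ∧
      ∀ ε x h : ℝ, 0 ≤ ε → |x - x₀| < δ → 0 < h → h < h₀ →
        |MOPWENO.uMinus r m n ε (MOPWENO.cellAverage u x h) 0 - u (x + h / 2)|
            ≤ C * h ^ (2 * r - 1) ∧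
        |MOPWENO.uPlus r m n ε (MOPWENO.cellAverage u x h) 0 - u (x + h / 2)|
            ≤ C * h ^ (2 * r - 1) ∧
        |MOPWENO.semiDiscrete r m n ε f α h (MOPWENO.cellAverage u x h) 0
              - -(1 / h) * (f (u (x + h / 2)) - f (u (x - h / 2)))|
            ≤ C * h ^ (2 * r - 1) := by
  -- With `q = r - 1 - ncp > 0` the hypothesis reads `1 + ncp ≤ n q`; adding `q` to both sides gives
  -- `r ≤ (n + 1) q`.
  have hord : r ≤ (r - (ncp + 1)) * (n + 1) := by
    obtain ⟨q, rfl⟩ : ∃ q, r = ncp + 1 + q := ⟨r - (ncp + 1), by omega⟩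
    have hq : (0 : ℝ) < q := by exact_mod_cast (by omega : 0 < q)
    rw [show ((ncp + 1 + q : ℕ) : ℝ) - 1 - ncp = q by push_cast; ring, div_le_iff₀ hq] at hreq
    have : 1 + ncp ≤ n * q := by exact_mod_cast hreq
    rw [Nat.add_sub_cancel_left]
    nlinarith
  obtain ⟨K, δ, E, hK, hδ, hE, hE', hlip, hrec⟩ :=
    exists_mopRecon_expansion (by omega : 1 ≤ ncp + 1) hcp_lt hwd hord hu hcrit.2
  obtain ⟨L, ρ, hL, hρ, hflux⟩ := hf.exists_bound_sub_sub_sub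
  obtain ⟨η, hη, hηK⟩ := exists_pos_forall_mul_abs_le (2 * K) (half_pos hρ)
  -- The first summand comes from the difference `3K h^(2r)` of the two boundary errors, the second
  -- from one error `2K h^(2r-1)` times `|a - b| ≤ K h`.
  set D : ℝ := L * (3 * K) + L * (2 * K) * K with hD
  set h₀ := min (min 1 (δ / 4)) (η / 2) with hh₀
  have hh₀pos : 0 < h₀ := lt_min (lt_min one_pos (by positivity)) (by positivity)
  refine ⟨2 * K + (D + |α| * (3 * K)), min (δ / 4) (η / 2), h₀,
    lt_min (by positivity) (by positivity), hh₀pos,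
    fun ε x h hε hx hh hhh => ?_⟩
  simp only [hh₀, lt_min_iff] at hhh hx
  obtain ⟨⟨hh1, hhδ⟩, hhη⟩ := hhh
  obtain ⟨hxδ, hxη⟩ := hx
  have hhabs : |h| = h := abs_of_pos hh
  have hnegabs : |-h| = h := by rw [abs_neg, hhabs]
  have hD0 : 0 ≤ D := by positivity
  have hpow : h ^ (2 * r) = h ^ (2 * r - 1) * h := by rw [← pow_succ]; congr 1; omega
  have hP0 : 0 ≤ h ^ (2 * r - 1) := by positivity
  have hPle : h ^ (2 * r - 1) ≤ h := pow_le_of_le_one hh.le hh1.le (by omega)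
  have hshift : ∀ t : ℝ, |t| ≤ 1 → |x + t * h - x₀| < δ ∧ |x + t * h - x₀| < η := by
    intro t ht
    have h1 : |x + t * h - x₀| ≤ |x - x₀| + h := by
      rw [show x + t * h - x₀ = (x - x₀) + t * h by ring]
      refine (abs_add_le _ _).trans (add_le_add le_rfl ?_)
      rw [abs_mul, hhabs]
      nlinarith
    constructor <;> linarith
  -- Four instances are needed: centres `x`, `x - h` with `k = h` for the left-biased values, and `x
  -- + h`, `x` with `k = -h` for the right-biased ones.
  have hcentre : ∀ (t k : ℝ), |t| ≤ 1 → |k| = h →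
      |mopRecon r m n ε (cellAverage u (x + t * h) k) - u (x + t * h + k / 2) - E (x + t * h) k| ≤
        K * h ^ (2 * r) := by
    intro t k ht hk
    have := hrec ε (x + t * h) k hε (hshift t ht).1 (abs_pos.1 (hk ▸ hh)) (by rw [hk]; linarith)
    rwa [hk] at this
  set a := u (x + h / 2) with ha
  set b := u (x - h / 2) with hb
  set uM := uMinus r m n ε (cellAverage u x h) 0 with huM
  set uM' := uMinus r m n ε (cellAverage u x h) (-1) with huM'
  set uP := uPlus r m n ε (cellAverage u x h) 0 with huP
  set uP' := uPlus r m n ε (cellAverage u x h) (-1) with huP'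
  have hM1 : |uM - a - E x h| ≤ K * h ^ (2 * r) := by
    have := hcentre 0 h (by simp) hhabs
    simp only [zero_mul, add_zero] at this
    rw [huM, uMinus_cellAverage]
    simpa using this
  have hM2 : |uM' - b - E (x - h) h| ≤ K * h ^ (2 * r) := by
    have := hcentre (-1) h (by simp) hhabs
    rw [show x + -1 * h = x - h by ring, show x - h + h / 2 = x - h / 2 by ring] at this
    rw [huM', uMinus_cellAverage]
    push_cast
    rwa [show x + -1 * h = x - h by ring]
  have hP1 : |uP - a - E (x + h) (-h)| ≤ K * h ^ (2 * r) := by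
    have := hcentre 1 (-h) (by simp) hnegabs
    rw [show x + 1 * h = x + h by ring, show x + h + -h / 2 = x + h / 2 by ring] at this
    rw [huP, uPlus_cellAverage]
    push_cast
    norm_num
    exact this
  have hP2 : |uP' - b - E x (-h)| ≤ K * h ^ (2 * r) := by
    have := hcentre 0 (-h) (by simp) hnegabs
    rw [show x + 0 * h = x by ring, show x + -h / 2 = x - h / 2 by ring] at this
    rw [huP', uPlus_cellAverage]
    push_cast
    norm_num
    exact this
  have hsize : ∀ {w c E₁ : ℝ}, |w - c - E₁| ≤ K * h ^ (2 * r) → |E₁| ≤ K * h ^ (2 * r - 1) →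
      |w - c| ≤ 2 * K * h ^ (2 * r - 1) := by
    intro w c E₁ h1 h2
    have h3 := abs_add_le (w - c - E₁) E₁
    rw [sub_add_cancel] at h3
    have h4 : K * h ^ (2 * r) ≤ K * h ^ (2 * r - 1) := by
      rw [hpow, ← mul_assoc]
      exact mul_le_of_le_one_right (by positivity) hh1.le
    linarith
  -- Two remainders and one variation of `E`, each at most `K h^(2r)`.
  have hdiff : ∀ {w c w' c' E₁ E₂ : ℝ}, |w - c - E₁| ≤ K * h ^ (2 * r) →
      |w' - c' - E₂| ≤ K * h ^ (2 * r) → |E₁ - E₂| ≤ K * h ^ (2 * r) →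
      |(w - c) - (w' - c')| ≤ 3 * K * h ^ (2 * r) := by
    intro w c w' c' E₁ E₂ h1 h2 h3
    rw [abs_le] at *
    constructor <;> linarith
  have hEM : |E x h - E (x - h) h| ≤ K * h ^ (2 * r) := by
    have := hE' x (x - h) h
    rw [sub_sub_cancel, hhabs, mul_assoc, ← hpow] at this
    exact this
  have hEP : |E (x + h) (-h) - E x (-h)| ≤ K * h ^ (2 * r) := by
    have := hE' (x + h) x (-h)
    rw [add_sub_cancel_left, hhabs, hnegabs, mul_assoc, ← hpow] at this
    exact this
  have hEb : ∀ y k, |k| = h → |E y k| ≤ K * h ^ (2 * r - 1) := fun y k hk => hk ▸ hE y k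
  have sM := hsize hM1 (hEb _ _ hhabs)
  have sM' := hsize hM2 (hEb _ _ hhabs)
  have sP := hsize hP1 (hEb _ _ hnegabs)
  have sP' := hsize hP2 (hEb _ _ hnegabs)
  have dM := hdiff hM1 hM2 hEM
  have dP := hdiff hP1 hP2 hEP
  have hsh1 := hshift (1 / 2) (by rw [abs_of_pos] <;> norm_num)
  have hsh2 := hshift (-(1 / 2)) (by rw [abs_neg, abs_of_pos] <;> norm_num)
  rw [show x + 1 / 2 * h = x + h / 2 by ring] at hsh1
  rw [show x + -(1 / 2) * h = x - h / 2 by ring] at hsh2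
  have hab : |a - b| ≤ K * h := by
    have := hlip _ _ hsh1.1 hsh2.1
    rwa [show x + h / 2 - (x - h / 2) = h by ring, hhabs] at this
  have hnear : ∀ y, |y - x₀| < δ → |y - x₀| < η → |u y - u x₀| < ρ := by
    intro y hy hy'
    have h1 := hlip y x₀ hy (by rw [sub_self, abs_zero]; exact hδ)
    have h2 := hηK (y - x₀) hy'
    nlinarith [mul_nonneg hK (abs_nonneg (y - x₀))]
  have hsmall : ∀ {e : ℝ}, |e| ≤ 2 * K * h ^ (2 * r - 1) → |e| < ρ := by
    intro e he
    have h1 := hηK h (by rw [hhabs]; linarith)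
    rw [hhabs] at h1
    have h2 : 2 * K * h ^ (2 * r - 1) ≤ 2 * K * h := mul_le_mul_of_nonneg_left hPle (by positivity)
    linarith
  have hF : ∀ {w w' : ℝ}, |w - a| ≤ 2 * K * h ^ (2 * r - 1) → |w' - b| ≤ 2 * K * h ^ (2 * r - 1) →
      |(w - a) - (w' - b)| ≤ 3 * K * h ^ (2 * r) →
      |(f w - f a) - (f w' - f b)| ≤ D * h ^ (2 * r) := by
    intro w w' h1 h2 h3
    have := hflux a b (w - a) (w' - b) (hnear _ hsh1.1 hsh1.2) (hnear _ hsh2.1 hsh2.2)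
      (hsmall h1) (hsmall h2)
    rw [add_sub_cancel, add_sub_cancel] at this
    refine this.trans ?_
    have h4 : L * |w' - b| * |a - b| ≤ L * (2 * K * h ^ (2 * r - 1)) * (K * h) :=
      mul_le_mul (mul_le_mul_of_nonneg_left h2 hL) hab (abs_nonneg _) (by positivity)
    have h5 := mul_le_mul_of_nonneg_left h3 hL
    have h6 : L * (2 * K * h ^ (2 * r - 1)) * (K * h) = L * (2 * K) * K * h ^ (2 * r) := by
      rw [hpow]; ring
    rw [hD]
    linarith
  have FM := hF sM sM' dM
  have FP := hF sP sP' dP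
  have hαK : 0 ≤ |α| * (3 * K) := by positivity
  have hCle : 2 * K * h ^ (2 * r - 1) ≤ (2 * K + (D + |α| * (3 * K))) * h ^ (2 * r - 1) :=
    mul_le_mul_of_nonneg_right (by linarith) hP0
  refine ⟨sM.trans hCle, sP.trans hCle, ?_⟩
  -- In the viscosity term the exact values `a`, `b` cancel between the biases, so it too involves
  -- only differences of errors, and the whole bracket is `O(h^(2r))` before division by `2h`.
  have e : semiDiscrete r m n ε f α h (cellAverage u x h) 0 - -(1 / h) * (f a - f b) =
      -(1 / (2 * h)) * (((f uM - f a) - (f uM' - f b)) + ((f uP - f a) - (f uP' - f b)) -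
        α * (((uP - a) - (uP' - b)) - ((uM - a) - (uM' - b)))) := by
    rw [semiDiscrete, numFlux, numFlux, lxfFlux, lxfFlux, zero_sub, ← huM, ← huM', ← huP, ← huP']
    field_simp
    ring
  have hα : |α * (((uP - a) - (uP' - b)) - ((uM - a) - (uM' - b)))| ≤
      |α| * (6 * K * h ^ (2 * r)) := by
    rw [abs_mul]
    refine mul_le_mul_of_nonneg_left ((abs_sub _ _).trans ?_) (abs_nonneg _)
    linarith
  have htot : |((f uM - f a) - (f uM' - f b)) + ((f uP - f a) - (f uP' - f b)) -
        α * (((uP - a) - (uP' - b)) - ((uM - a) - (uM' - b)))| ≤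
      2 * (D + |α| * (3 * K)) * h ^ (2 * r) := by
    refine (abs_sub _ _).trans ?_
    have := abs_add_le ((f uM - f a) - (f uM' - f b)) ((f uP - f a) - (f uP' - f b))
    linarith
  rw [e, abs_mul, abs_neg, abs_of_pos (by positivity : 0 < 1 / (2 * h))]
  calc _ ≤ 1 / (2 * h) * (2 * (D + |α| * (3 * K)) * h ^ (2 * r)) :=
        mul_le_mul_of_nonneg_left htot (by positivity)
    _ = (D + |α| * (3 * K)) * h ^ (2 * r - 1) := by
        rw [hpow]; field_simp
    _ ≤ _ := mul_le_mul_of_nonneg_right (by linarith) hP0
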